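/- Let $\mathbb{T}^2=(\mathbb{R}/2\pi\mathbb{Z})^2$, and for real $s$ let $\|f\|_{H^s}=\big(\sum_{k\in\mathbb{Z}^2}(1+|k|^2)^{s}|\hat f_k|^2\big)^{1/2}$, where $\hat f_k=(2\pi)^{-2}\int_{[0,2\pi]^2}f(x)e^{-ik\cdot x}\,dx$. Let $J=\begin{pmatrix}0&1\\-1&0\end{pmatrix}$, and for a function $g$ with average $0$ let $\Delta^{-1}g$ be the solution $\psi$ with average $0$ of $\Delta\psi=g$ on $\mathbb{T}^2$. For $s\ge 2$ and a real-valued $\omega_0\in H^s(\mathbb{T}^2)$ with average $0$: - $\varphi_{E,t}(\omega_0)=\omega(t)$, where $\omega\in C^0([0,\infty),H^s(\mathbb{T}^2))\cap C^1([0,\infty),H^{s-1}(\mathbb{T}^2))$ is the solution of the Euler equation $\partial_t\omega-J\nabla\Delta^{-1}\omega\cdot\nabla\omega=0$, $\omega(0)=\omega_0$; - $\varphi_{F,t}(\omega_0)=\omega_0\circ\Psi_t$, where $\Psi_t$ is the flow of the vector field $J\nabla\psi$ with $\psi=\Delta^{-1}\omega_0$; this is the solution of the frozen equation $\partial_t f-J\nabla\psi\cdot\nabla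 f=0$, $f(0)=\omega_0$. **Proposition.** For every real $s\ge 2$ there exist constants $L_0,L_1>0$, depending only on $s$, such that for every $B>0$, every $\omega_0\in H^s(\mathbb{T}^2)$ with average $0$ and $\|\omega_0\|_{H^s}\le B$, and every real $T_0<\frac{1}{L_0B}$, one has for all $t\in[0,T_0]$ $$\|\varphi_{E,t}(\omega_0)\|_{H^s}\le\min\big(2,e^{BL_1t}\big)\|\omega_0\|_{H^s}$$ and $\varphi_{F,t}(\omega_0)\in H^s(\mathbb{T}^2)$ with $$\|\varphi_{F,t}(\omega_0)\|_{H^s}\le\min\big(2,e^{BL_1t}\big)\|\omega_0\|_{H^s}.$$ -/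

import Mathlib

open Real Set Filter Topology MeasureTheory

noncomputable section

/-! Functions on the torus `(ℝ/2πℤ)²` are the functions on `ℝ² = Fin 2 → ℝ` that are `2π`-periodic in
each variable. Elements of Lebesgue and Sobolev spaces are represented by functions, and equations
between them hold almost everywhere. -/

/-- `f` is `2π`-periodic in each variable. -/
def TorusPeriodic (f : (Fin 2 → ℝ) → ℝ) : Prop :=
  ∀ (i : Fin 2) (x : Fin 2 → ℝ), f (x + Pi.single i (2 * π)) = f x

/-- The periodicity cell `[0, 2π]²`. -/
def torusCell : Set (Fin 2 → ℝ) := Icc 0 (fun _ => 2 * π)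

/-- The Fourier coefficient `f̂ₖ = (2π)⁻² ∫ f(x) exp(-i k·x) dx` (normalized Lebesgue measure). -/
def torusFourierCoeff (f : (Fin 2 → ℝ) → ℝ) (k : Fin 2 → ℤ) : ℂ :=
  ((2 * π : ℝ) ^ 2)⁻¹ •
    ∫ x in torusCell, (f x : ℂ) * Complex.exp (-(Complex.I * ((∑ i, (k i : ℝ) * x i : ℝ) : ℂ)))

/-- The term `⟨k⟩^{2s} |f̂ₖ|²` of the Sobolev norm, where `⟨k⟩² = 1 + k₁² + k₂²`. -/
def sobolevTerm (s : ℝ) (f : (Fin 2 → ℝ) → ℝ) (k : Fin 2 → ℤ) : ℝ :=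
  (1 + ∑ i, (k i : ℝ) ^ 2) ^ s * ‖torusFourierCoeff f k‖ ^ 2

/-- `f` belongs to the periodic Sobolev space `H^s` of the two-dimensional torus (for `0 ≤ s`). -/
structure MemSobolev (s : ℝ) (f : (Fin 2 → ℝ) → ℝ) : Prop where
  periodic : TorusPeriodic f
  memLp : MemLp f 2 (volume.restrict torusCell)
  summable : Summable (sobolevTerm s f)

/-- The norm of `H^s`; meaningful for `f` with `MemSobolev s f`. -/
def sobolevNorm (s : ℝ) (f : (Fin 2 → ℝ) → ℝ) : ℝ :=
  √(∑' k, sobolevTerm s f k)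

/-- `f` has average `0` on the torus. -/
def MeanZero (f : (Fin 2 → ℝ) → ℝ) : Prop := ∫ x in torusCell, f x = 0

/-- The classical partial derivative `∂ᵢ f`. -/
def partialD (i : Fin 2) (f : (Fin 2 → ℝ) → ℝ) (x : Fin 2 → ℝ) : ℝ :=
  fderiv ℝ f x (Pi.single i 1)

/-- `g` is the weak partial derivative `∂ᵢ f` on the torus: test functions are the smooth periodic
functions. -/
structure HasWeakPartial (i : Fin 2) (f g : (Fin 2 → ℝ) → ℝ) : Prop where
  periodic : TorusPeriodic g
  integrable : IntegrableOn g torusCell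
  integral_eq : ∀ φ : (Fin 2 → ℝ) → ℝ, ContDiff ℝ ((⊤ : ℕ∞) : WithTop ℕ∞) φ → TorusPeriodic φ →
    ∫ x in torusCell, f x * partialD i φ x = -∫ x in torusCell, g x * φ x

/-- `ψ = Δ⁻¹ ω`: the solution with average `0` of the Poisson equation `Δψ = ω` on the torus. It is
used for `ω` in `H^s` with `2 ≤ s` and average `0`; the solution is then in `H^{s+2}`, hence
(represented by a function) of class `C²`. -/
structure IsInvLaplacian (ω ψ : (Fin 2 → ℝ) → ℝ) : Prop where
  periodic : TorusPeriodic ψ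
  contDiff : ContDiff ℝ 2 ψ
  meanZero : MeanZero ψ
  laplacian_eq : (fun x => ∑ i, partialD i (partialD i ψ) x) =ᵐ[volume] ω

/-- The vector field `J∇ψ = (∂₂ψ, -∂₁ψ)`. -/
def symplecticGrad (ψ : (Fin 2 → ℝ) → ℝ) (x : Fin 2 → ℝ) : Fin 2 → ℝ :=
  ![partialD 1 ψ x, -partialD 0 ψ x]

/-- `ω ∈ C⁰([0,∞), H^s) ∩ C¹([0,∞), H^{s-1})` solves the Euler equation
`∂ₜω - J∇Δ⁻¹ω · ∇ω = 0` with `ω(0) = ω₀`. -/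
structure IsEulerSolution (s : ℝ) (ω₀ : (Fin 2 → ℝ) → ℝ) (ω : ℝ → (Fin 2 → ℝ) → ℝ) : Prop where
  mem : ∀ t, 0 ≤ t → MemSobolev s (ω t)
  continuous : ∀ t, 0 ≤ t →
    Tendsto (fun r => sobolevNorm s (fun x => ω r x - ω t x)) (𝓝[Ici 0] t) (𝓝 0)
  initial : ω 0 =ᵐ[volume] ω₀
  /-- `ω'` is the time derivative, in the space `H^{s-1}`. -/
  equation : ∃ ω' : ℝ → (Fin 2 → ℝ) → ℝ,
    (∀ t, 0 ≤ t → MemSobolev (s - 1) (ω' t)) ∧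
    (∀ t, 0 ≤ t →
      Tendsto (fun r => sobolevNorm (s - 1) (fun x => ω' r x - ω' t x)) (𝓝[Ici 0] t) (𝓝 0)) ∧
    (∀ t, 0 ≤ t →
      Tendsto (fun r => sobolevNorm (s - 1) (fun x => (ω r x - ω t x) / (r - t) - ω' t x))
        (𝓝[Ici 0 \ {t}] t) (𝓝 0)) ∧
    (∀ t, 0 ≤ t → ∃ (ψ : (Fin 2 → ℝ) → ℝ) (g : Fin 2 → (Fin 2 → ℝ) → ℝ),
      IsInvLaplacian (ω t) ψ ∧ (∀ i, HasWeakPartial i (ω t) (g i)) ∧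
      ∀ᵐ x, ω' t x - ∑ i, symplecticGrad ψ x i * g i x = 0)

/-- `Ψ` is the (global) flow of the autonomous vector field `X` on `ℝ²`. -/
def IsFlowOf (X : (Fin 2 → ℝ) → (Fin 2 → ℝ)) (Ψ : ℝ → (Fin 2 → ℝ) → (Fin 2 → ℝ)) : Prop :=
  ∀ x, Ψ 0 x = x ∧ ∀ t, HasDerivAt (fun r => Ψ r x) (X (Ψ t x)) t

/-- `f` is the solution of the frozen equation `∂ₜf - J∇ψ · ∇f = 0`, `Δψ = ω₀`, `f(0) = ω₀`:
the function `f(t,x) = ω₀(Ψₜ(x))`, where `Ψ` is the flow of `J∇ψ`. -/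
def IsFrozenSolution (ω₀ : (Fin 2 → ℝ) → ℝ) (f : ℝ → (Fin 2 → ℝ) → ℝ) : Prop :=
  ∃ (ψ : (Fin 2 → ℝ) → ℝ) (Ψ : ℝ → (Fin 2 → ℝ) → (Fin 2 → ℝ)),
    IsInvLaplacian ω₀ ψ ∧ IsFlowOf (symplecticGrad ψ) Ψ ∧ ∀ t x, f t x = ω₀ (Ψ t x)

end

/-!
Both equations transport `f` along `J∇ψ`, where `ψ` is two derivatives smoother than the datum. In
Fourier variables, with `p = ψ̂` and `a = f̂`, the transport term has the coefficients
`∑ₗ (k × l) p_{k-l} aₗ` (`torusFourierCoeff_transport`). The symbol `k × l` is antisymmetric and `ψ`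
is real, so in the derivative of a weighted energy `∑ₖ m(k) |aₖ|²` the weight appears only through
differences `m(k) - m(l)` (`abs_sum_energy_le`). For `m(k) = ⟨k⟩^{2s}` this commutator gains one
derivative: `|m(k) - m(l)| |k × l|` is at most a constant times
`⟨k-l⟩² ⟨k⟩^s ⟨l⟩^s + ⟨k-l⟩^{s+2} (⟨k⟩^s + ⟨l⟩^s)`. Since `⟨k⟩^{-s}` is square-summable on `ℤ²` for
`s > 1`, Young's inequality bounds the energy derivative by `C ‖ψ‖_{H^{s+2}} ‖f‖²_{H^s}`
(`trilinear_le`).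

For the Euler equation the energy with the full weight cannot be differentiated directly, because
`∂ₜω` is only in `H^{s-1}`. The weight is therefore composed with a tent function: this is a
contraction, so the same bound holds, and it leaves only finitely many frequencies. In the limit the
squared norm `y` satisfies `y' ≤ C y^{3/2}` in the sense of difference quotients
(`IsEulerSolution.sobolevNorm_sq_sub_le`), and comparison with an exponential gives the claim on the
time scale `1/B` (`IsEulerSolution.sobolevNorm_le`).

For the frozen equation `ω₀ ∘ Ψₜ` has to be shown to stay in `H^s`. The Galerkin truncations to
frequency boxes are linear ordinary differential equations, and they satisfy the energy estimate
uniformly (`galerkin_energy_le`). Along the trajectories of the flow they change only by the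
high-frequency part of their transport term, which lies in a bounded set of `H^1` because `s ≥ 2` and
hence tends to zero in `L¹` (`integral_norm_tail_le`); composition with the flow is bounded on `L¹`
because the inverse flow is Lipschitz (`IsFlowOf.exists_lintegral_comp_le`). So the Fourier
coefficients of the truncations converge to those of `ω₀ ∘ Ψₜ` (`tendsto_galerkin_coeff`), and the
uniform bound passes to the limit on finite sets of frequencies (`memSobolev_comp_flow`).
-/

/-! ### Fourier monomials and coefficients on the cell -/

/-- The Fourier monomial `x ↦ exp(i k·x)`. -/
noncomputable def torusExp (k : Fin 2 → ℤ) (x : Fin 2 → ℝ) : ℂ :=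
  Complex.exp (Complex.I * ((∑ i, (k i : ℝ) * x i : ℝ) : ℂ))

/-- `F` is `2π`-periodic in each variable, for values in any type. -/
def CellPeriodic {α : Type*} (F : (Fin 2 → ℝ) → α) : Prop :=
  ∀ (i : Fin 2) (x : Fin 2 → ℝ), F (x + Pi.single i (2 * π)) = F x

/-- The Fourier coefficients of a complex-valued function. -/
noncomputable def fourierCoeffC (F : (Fin 2 → ℝ) → ℂ) (k : Fin 2 → ℤ) : ℂ :=
  ((2 * π : ℝ) ^ 2)⁻¹ • ∫ x in torusCell, F x * torusExp (-k) x

theorem torusExp_eq_cexp_neg (k : Fin 2 → ℤ) (x : Fin 2 → ℝ) :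
    torusExp (-k) x = Complex.exp (-(Complex.I * ((∑ i, (k i : ℝ) * x i : ℝ) : ℂ))) := by
  simp [torusExp, Fin.sum_univ_two]
  ring_nf

theorem torusFourierCoeff_eq (f : (Fin 2 → ℝ) → ℝ) (k : Fin 2 → ℤ) :
    torusFourierCoeff f k = fourierCoeffC (fun x => (f x : ℂ)) k := by
  simp only [torusFourierCoeff, fourierCoeffC, torusExp_eq_cexp_neg]

theorem torusExp_add (k l : Fin 2 → ℤ) (x : Fin 2 → ℝ) :
    torusExp (k + l) x = torusExp k x * torusExp l x := by
  simp only [torusExp, ← Complex.exp_add, ← mul_add]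
  congr 2
  simp [add_mul, Finset.sum_add_distrib]

@[simp] theorem torusExp_zero (x : Fin 2 → ℝ) : torusExp 0 x = 1 := by simp [torusExp]

@[simp] theorem norm_torusExp (k : Fin 2 → ℤ) (x : Fin 2 → ℝ) : ‖torusExp k x‖ = 1 := by
  rw [torusExp, mul_comm, Complex.norm_exp_ofReal_mul_I]

theorem torusExp_neg (k : Fin 2 → ℤ) (x : Fin 2 → ℝ) :
    torusExp (-k) x = (starRingEnd ℂ) (torusExp k x) := by
  rw [torusExp_eq_cexp_neg, torusExp, ← Complex.exp_conj]
  simp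

theorem contDiff_torusExp (k : Fin 2 → ℤ) {n : WithTop ℕ∞} : ContDiff ℝ n (torusExp k) := by
  unfold torusExp
  have : ContDiff ℝ n (fun x : Fin 2 → ℝ => ((∑ i, (k i : ℝ) * x i : ℝ) : ℂ)) := by
    have h : ContDiff ℝ n (fun x : Fin 2 → ℝ => ∑ i, (k i : ℝ) * x i) :=
      ContDiff.sum fun i _ => contDiff_const.mul (contDiff_apply ℝ ℝ i)
    exact Complex.ofRealCLM.contDiff.comp h
  exact (contDiff_const.mul this).cexp

theorem continuous_torusExp (k : Fin 2 → ℤ) : Continuous (torusExp k) :=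
  (contDiff_torusExp k (n := 0)).continuous

theorem cellPeriodic_torusExp (k : Fin 2 → ℤ) : CellPeriodic (torusExp k) := by
  intro i x
  have h : ∑ j, (k j : ℝ) * (x + Pi.single i (2 * π) : Fin 2 → ℝ) j
      = ∑ j, (k j : ℝ) * x j + k i * (2 * π) := by
    fin_cases i <;> simp [Fin.sum_univ_two] <;> ring
  simp only [torusExp, h]
  rw [Complex.ofReal_add, mul_add, Complex.exp_add]
  have : Complex.exp (Complex.I * ((k i * (2 * π) : ℝ) : ℂ)) = 1 := by
    rw [Complex.exp_eq_one_iff]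
    exact ⟨k i, by push_cast; ring⟩
  rw [this, mul_one]

/-- The differential of `exp(i k·x)` in the direction `v` multiplies by `i k·v`. -/
theorem hasFDerivAt_torusExp (k : Fin 2 → ℤ) (x : Fin 2 → ℝ) :
    HasFDerivAt (torusExp k) ((Complex.ofRealCLM.comp
      (∑ i, (k i : ℝ) • ContinuousLinearMap.proj (R := ℝ) (φ := fun _ : Fin 2 => ℝ) i)).smulRight
        (Complex.I * torusExp k x)) x := by
  have h1 : HasFDerivAt (fun x : Fin 2 → ℝ => Complex.I * ((∑ i, (k i : ℝ) * x i : ℝ) : ℂ))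
      (Complex.I • (Complex.ofRealCLM.comp
      (∑ i, (k i : ℝ) • ContinuousLinearMap.proj (R := ℝ) (φ := fun _ : Fin 2 => ℝ) i))) x := by
    have h2 := (Complex.ofRealCLM.comp
      (∑ i, (k i : ℝ) • ContinuousLinearMap.proj (R := ℝ) (φ := fun _ : Fin 2 => ℝ) i)).hasFDerivAt
        (x := x)
    convert! h2.const_mul Complex.I using 2
  convert! h1.cexp using 1
  ext v
  simp [torusExp]
  ring

theorem fderiv_torusExp_apply (k : Fin 2 → ℤ) (x v : Fin 2 → ℝ) :
    fderiv ℝ (torusExp k) x v = Complex.I * (∑ i, (k i : ℂ) * v i) * torusExp k x := by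
  rw [(hasFDerivAt_torusExp k x).fderiv]
  simp
  ring

theorem fderiv_torusExp_single (k : Fin 2 → ℤ) (x : Fin 2 → ℝ) (i : Fin 2) :
    fderiv ℝ (torusExp k) x (Pi.single i 1) = Complex.I * k i * torusExp k x := by
  rw [fderiv_torusExp_apply]
  fin_cases i <;> simp

theorem isCompact_torusCell : IsCompact torusCell := isCompact_Icc

theorem measurableSet_torusCell : MeasurableSet torusCell := measurableSet_Icc

theorem volume_real_torusCell : volume.real torusCell = (2 * π) ^ 2 := by
  rw [Measure.real, torusCell, Real.volume_Icc_pi]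
  simp [pi_pos.le]
  
instance isFiniteMeasure_torusCell : IsFiniteMeasure (volume.restrict torusCell) :=
  ⟨by simpa using isCompact_torusCell.measure_lt_top⟩

theorem integrableOn_cell_of_continuous {E : Type*} [NormedAddCommGroup E] {F : (Fin 2 → ℝ) → E}
    (hF : Continuous F) : IntegrableOn F torusCell :=
  hF.continuousOn.integrableOn_compact isCompact_torusCell

theorem integrableOn_mul_torusExp {F : (Fin 2 → ℝ) → ℂ} (hF : IntegrableOn F torusCell)
    (k : Fin 2 → ℤ) : IntegrableOn (fun x => F x * torusExp k x) torusCell := by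
  refine Integrable.mul_bdd (c := 1) hF
    (continuous_torusExp k).aestronglyMeasurable (Eventually.of_forall fun x => by simp)

/-- The integral of a partial derivative of a periodic function over the cell vanishes: by the
divergence theorem it is the difference of the integrals over two opposite faces. -/
theorem integral_fderiv_single_eq_zero {G : (Fin 2 → ℝ) → ℂ} (hG : ContDiff ℝ 1 G)
    (hper : CellPeriodic G) (i : Fin 2) :
    ∫ x in torusCell, fderiv ℝ G x (Pi.single i 1) = 0 := by
  have hle : (0 : Fin 2 → ℝ) ≤ fun _ => 2 * π := fun j => by simp [pi_pos.le]
  have hcont : Continuous fun x => fderiv ℝ G x (Pi.single i 1) :=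
    (hG.continuous_fderiv (by simp)).clm_apply continuous_const
  have key := integral_divergence_of_hasFDerivAt_off_countable' (n := 1) (E := ℂ)
    (0 : Fin 2 → ℝ) (fun _ => 2 * π) hle
    (fun j x => if j = i then G x else 0)
    (fun j x => if j = i then fderiv ℝ G x else 0) ∅ countable_empty
    (fun j => by
      by_cases h : j = i <;> simp [h, continuousOn_const, hG.continuous.continuousOn])
    (fun x _ j => by
      by_cases h : j = i
      · simpa [h] using (hG.differentiable (by simp) x).hasFDerivAt
      · simpa [h] using hasFDerivAt_const (0 : ℂ) x)
    (by
      refine IntegrableOn.congr_fun (f := fun x => fderiv ℝ G x (Pi.single i 1))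
        (integrableOn_cell_of_continuous hcont) (fun x _ => ?_) measurableSet_Icc
      rw [Finset.sum_eq_single i] <;> simp +contextual)
  have h1 : ∀ x, (∑ j, (if j = i then fderiv ℝ G x else 0) (Pi.single j 1))
      = fderiv ℝ G x (Pi.single i 1) := fun x => by
    rw [Finset.sum_eq_single i] <;> simp +contextual
  simp only [h1] at key
  rw [torusCell, key]
  refine Finset.sum_eq_zero fun j _ => ?_
  by_cases h : j = i
  · subst h
    simp only [if_true]
    rw [sub_eq_zero]
    refine integral_congr_ae (Eventually.of_forall fun y => ?_)
    refine Eq.trans (congrArg G ?_) (hper j _)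
    ext m
    obtain rfl | ⟨l, rfl⟩ := Fin.eq_self_or_eq_succAbove j m
    · simp
    · simp [Fin.succAbove_ne]
  · simp [h]

theorem integral_torusExp (k : Fin 2 → ℤ) :
    ∫ x in torusCell, torusExp k x = if k = 0 then ((2 * π : ℝ) ^ 2 : ℂ) else 0 := by
  split_ifs with h
  · subst h
    simp [volume_real_torusCell]
  · obtain ⟨i, hi⟩ := Function.ne_iff.mp h
    have h1 := integral_fderiv_single_eq_zero (contDiff_torusExp k) (cellPeriodic_torusExp k) i
    simp only [fderiv_torusExp_single] at h1
    rw [integral_const_mul] at h1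
    simpa [show (k i : ℂ) ≠ 0 by exact_mod_cast hi] using h1

/-- Integration by parts: `∂ᵢ` acts on Fourier coefficients as multiplication by `i kᵢ`. -/
theorem fourierCoeffC_fderiv {F : (Fin 2 → ℝ) → ℂ} (hF : ContDiff ℝ 1 F) (hper : CellPeriodic F)
    (i : Fin 2) (k : Fin 2 → ℤ) :
    fourierCoeffC (fun x => fderiv ℝ F x (Pi.single i 1)) k
      = Complex.I * k i * fourierCoeffC F k := by
  have h1 := integral_fderiv_single_eq_zero (hF.mul (contDiff_torusExp (-k)))
    (fun j x => by simp only [hper j x, cellPeriodic_torusExp (-k) j x]) i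
  have h2 : ∀ x, fderiv ℝ (fun y => F y * torusExp (-k) y) x (Pi.single i 1)
      = fderiv ℝ F x (Pi.single i 1) * torusExp (-k) x
        - (Complex.I * k i) * (F x * torusExp (-k) x) := by
    intro x
    rw [fderiv_fun_mul (hF.differentiable (by simp) x)
      (hasFDerivAt_torusExp (-k) x).differentiableAt]
    simp [fderiv_torusExp_single]
    ring
  simp only [h2] at h1
  rw [integral_sub, integral_const_mul, sub_eq_zero] at h1
  · simp only [fourierCoeffC]
    rw [h1, mul_smul_comm]
  · exact integrableOn_mul_torusExp (integrableOn_cell_of_continuous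
      ((hF.continuous_fderiv (by simp)).clm_apply continuous_const)) _
  · exact (integrableOn_mul_torusExp (integrableOn_cell_of_continuous hF.continuous) _).const_mul _

theorem fourierCoeffC_torusExp (j k : Fin 2 → ℤ) :
    fourierCoeffC (torusExp j) k = if j = k then 1 else 0 := by
  simp only [fourierCoeffC, ← torusExp_add, integral_torusExp]
  have : ((2 * π : ℝ) ^ 2) ≠ 0 := by positivity
  by_cases h : j = k
  · subst h
    simp only [add_neg_cancel, if_true, Complex.real_smul]
    push_cast at *
    rw [inv_mul_cancel₀]
    simp
  · simp [h, ← sub_eq_add_neg, sub_eq_zero]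

/-! ### Parseval's identity and trigonometric series -/

section TorusTransfer

/-- The normalization of the measure on `ℝ / ℤ` under which Mathlib states Parseval's identity. -/
noncomputable local instance haarMeasureSpaceUnitAddCircle : MeasureSpace UnitAddCircle :=
  ⟨AddCircle.haarAddCircle⟩

/-- The inverse of the covering map from the cell to the torus `(ℝ/ℤ)²`, rescaled by `2π`. -/
noncomputable def torusToCell (y : UnitAddTorus (Fin 2)) : Fin 2 → ℝ :=
  (2 * π) • (UnitAddTorus.measurableEquivPiIoc 0 y).1

theorem measurePreserving_torusToCell :
    MeasurePreserving torusToCell volume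
      (ENNReal.ofReal (((2 * π) ^ 2)⁻¹) • volume.restrict torusCell) := by
  set S : Set (Fin 2 → ℝ) := {x | ∀ i, x i ∈ Ioc ((0 : Fin 2 → ℝ) i) ((0 : Fin 2 → ℝ) i + 1)}
  have hS : MeasurableSet S := MeasurableSet.univ_pi' (fun i => measurableSet_Ioc)
  have h1 := UnitAddTorus.measurePreserving_equivPiIoc (d := Fin 2) 0
  have h2 : MeasurePreserving (Subtype.val : S → (Fin 2 → ℝ)) (Measure.comap Subtype.val volume)
      (volume.restrict S) := ⟨measurable_subtype_coe, map_comap_subtype_coe hS _⟩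
  have h3 : MeasurePreserving (fun x : Fin 2 → ℝ => (2 * π) • x) (volume.restrict S)
      (ENNReal.ofReal (((2 * π) ^ 2)⁻¹) • volume.restrict torusCell) := by
    refine ⟨by fun_prop, ?_⟩
    have hpre : S = (fun x : Fin 2 → ℝ => (2 * π) • x) ⁻¹'
        (Set.pi univ fun _ => Ioc (0 : ℝ) (2 * π)) := by
      ext x
      simp only [S, mem_ofPred_eq, mem_preimage, mem_univ_pi, mem_Ioc, Pi.zero_apply, zero_add,
        Pi.smul_apply, smul_eq_mul]
      refine forall_congr' fun i => and_congr ?_ ?_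
      · rw [mul_pos_iff_of_pos_left (by positivity)]
      · rw [mul_le_iff_le_one_right (by positivity)]
    rw [hpre, ← Measure.restrict_map (by fun_prop)
      (MeasurableSet.univ_pi fun _ => measurableSet_Ioc),
      Measure.map_addHaar_smul _ (by positivity), Measure.restrict_smul]
    have h4 : (volume : Measure (Fin 2 → ℝ)).restrict (Set.pi univ fun _ => Ioc (0 : ℝ) (2 * π))
        = volume.restrict torusCell := by
      refine Measure.restrict_congr_set ?_
      exact Measure.univ_pi_Ioc_ae_eq_Icc (f := (0 : Fin 2 → ℝ)) (g := fun _ => 2 * π)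
    rw [h4]
    simp [abs_of_pos pi_pos]
  exact h3.comp (h2.comp h1)

theorem integral_torusToCell {E : Type*} [NormedAddCommGroup E] [NormedSpace ℝ E]
    {F : (Fin 2 → ℝ) → E} (hF : AEStronglyMeasurable F (volume.restrict torusCell)) :
    ∫ y, F (torusToCell y) = ((2 * π : ℝ) ^ 2)⁻¹ • ∫ x in torusCell, F x := by
  have h := integral_map measurePreserving_torusToCell.measurable.aemeasurable (f := F)
    (μ := volume) (by
      rw [measurePreserving_torusToCell.map_eq]
      exact hF.mono_ac (Measure.AbsolutelyContinuous.rfl.smul_left _))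
  rw [← h, measurePreserving_torusToCell.map_eq, integral_smul_measure,
    ENNReal.toReal_ofReal (by positivity)]

theorem mFourier_eq_torusExp (k : Fin 2 → ℤ) (y : UnitAddTorus (Fin 2)) :
    UnitAddTorus.mFourier k y = torusExp k (torusToCell y) := by
  have hy : (fun i => ((UnitAddTorus.measurableEquivPiIoc 0 y).1 i : UnitAddCircle)) = y :=
    (UnitAddTorus.measurableEquivPiIoc 0).symm_apply_apply y
  conv_lhs => rw [← hy]
  simp only [UnitAddTorus.mFourier, ContinuousMap.coe_mk, fourier_coe_apply, torusExp,
    ← Complex.exp_sum]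
  congr 1
  simp only [torusToCell, Pi.smul_apply, smul_eq_mul]
  push_cast
  rw [Finset.mul_sum]
  refine Finset.sum_congr rfl fun i _ => ?_
  simp
  ring

/-- **Parseval's identity** on the cell. -/
theorem hasSum_sq_fourierCoeffC {F : (Fin 2 → ℝ) → ℂ}
    (hF : MemLp F 2 (volume.restrict torusCell)) :
    HasSum (fun k => ‖fourierCoeffC F k‖ ^ 2) (((2 * π) ^ 2)⁻¹ * ∫ x in torusCell, ‖F x‖ ^ 2) := by
  have hG : MemLp (fun y => F (torusToCell y)) 2 volume := by
    refine MemLp.comp_measurePreserving (ν := ENNReal.ofReal (((2 * π) ^ 2)⁻¹) •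
      volume.restrict torusCell) ?_ measurePreserving_torusToCell
    exact hF.smul_measure (by simp)
  have key := UnitAddTorus.hasSum_sq_mFourierCoeff (hG.toLp _)
  have h1 : ∫ y, ‖hG.toLp _ y‖ ^ 2 = ((2 * π) ^ 2)⁻¹ * ∫ x in torusCell, ‖F x‖ ^ 2 := by
    rw [← smul_eq_mul, ← integral_torusToCell (F := fun x => ‖F x‖ ^ 2)
      (hF.aestronglyMeasurable.norm.pow 2)]
    refine integral_congr_ae ?_
    filter_upwards [hG.coeFn_toLp] with y hy
    rw [hy]
  have h2 : ∀ k, UnitAddTorus.mFourierCoeff (hG.toLp _) k = fourierCoeffC F k := by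
    intro k
    rw [fourierCoeffC, ← integral_torusToCell (F := fun x => F x * torusExp (-k) x)
      (hF.aestronglyMeasurable.mul (continuous_torusExp _).aestronglyMeasurable)]
    refine integral_congr_ae ?_
    filter_upwards [hG.coeFn_toLp] with y hy
    rw [hy, mFourier_eq_torusExp, smul_eq_mul, mul_comm]
  simpa only [h1, h2] using key

end TorusTransfer

/-- Fourier coefficients determine a square-integrable function. -/
theorem ae_eq_of_fourierCoeffC_eq {F G : (Fin 2 → ℝ) → ℂ}
    (hF : MemLp F 2 (volume.restrict torusCell)) (hG : MemLp G 2 (volume.restrict torusCell))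
    (h : ∀ k, fourierCoeffC F k = fourierCoeffC G k) : F =ᵐ[volume.restrict torusCell] G := by
  have key := hasSum_sq_fourierCoeffC (hF.sub hG)
  have h0 : ∀ k, fourierCoeffC (F - G) k = 0 := by
    intro k
    have : fourierCoeffC (F - G) k = fourierCoeffC F k - fourierCoeffC G k := by
      simp only [fourierCoeffC, Pi.sub_apply, sub_mul]
      rw [integral_sub (integrableOn_mul_torusExp (hF.integrable (by simp)) _)
        (integrableOn_mul_torusExp (hG.integrable (by simp)) _), smul_sub]
    rw [this, h, sub_self]
  simp only [h0, norm_zero, ne_eq, OfNat.ofNat_ne_zero, not_false_eq_true, zero_pow] at key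
  have h1 := hasSum_zero.unique key
  have h2 : ∫ x in torusCell, ‖(F - G) x‖ ^ 2 = 0 := by
    have : ((2 * π) ^ 2)⁻¹ ≠ 0 := by positivity
    simpa [this, pi_ne_zero] using h1.symm
  rw [integral_eq_zero_iff_of_nonneg (fun x => by positivity) (hF.sub hG).integrable_norm_pow'] at h2
  filter_upwards [h2] with x hx
  simpa [sub_eq_zero] using hx

theorem CellPeriodic.comp {α β : Type*} {F : (Fin 2 → ℝ) → α} (hF : CellPeriodic F) (g : α → β) :
    CellPeriodic (fun x => g (F x)) := fun i x => congrArg g (hF i x)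

theorem CellPeriodic.add_int {α : Type*} {F : (Fin 2 → ℝ) → α} (hF : CellPeriodic F)
    (m : Fin 2 → ℤ) (x : Fin 2 → ℝ) : F (x + fun i => m i * (2 * π)) = F x := by
  have h1 : ∀ (i : Fin 2) (n : ℤ) (x : Fin 2 → ℝ), F (x + Pi.single i (n * (2 * π))) = F x := by
    intro i n
    induction n using Int.induction_on with
    | zero => simp
    | succ n ih =>
      intro x
      have : x + Pi.single i (((n + 1 : ℤ) : ℝ) * (2 * π))
          = (x + Pi.single i (((n : ℤ) : ℝ) * (2 * π))) + Pi.single i (2 * π) := by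
        rw [add_assoc, ← Pi.single_add]; push_cast; ring_nf
      rw [this, hF, ih]
    | pred n ih =>
      intro x
      rw [← hF i]
      have : x + Pi.single i (((-n - 1 : ℤ) : ℝ) * (2 * π)) + Pi.single i (2 * π)
          = (x + Pi.single i (((-n : ℤ) : ℝ) * (2 * π))) := by
        rw [add_assoc, ← Pi.single_add]; push_cast; ring_nf
      rw [this, ih]
  have h2 : (x + fun i => m i * (2 * π))
      = (x + Pi.single 0 (m 0 * (2 * π))) + Pi.single 1 (m 1 * (2 * π)) := by
    ext i
    fin_cases i <;> simp
  rw [h2, h1, h1]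

theorem exists_add_int_mem_torusCell (x : Fin 2 → ℝ) :
    ∃ m : Fin 2 → ℤ, (x + fun i => m i * (2 * π)) ∈ torusCell := by
  refine ⟨fun i => -⌊x i / (2 * π)⌋, ?_, ?_⟩ <;> intro i
  · have := Int.floor_le (x i / (2 * π))
    rw [le_div_iff₀ (by positivity)] at this
    simp
    linarith
  · have := (Int.lt_floor_add_one (x i / (2 * π))).le
    rw [div_le_iff₀ (by positivity)] at this
    simp
    linarith

/-- A property that holds almost everywhere on the cell holds almost everywhere, when it is
periodic. -/
theorem ae_of_ae_cell {p : (Fin 2 → ℝ) → Prop} (hp : CellPeriodic p)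
    (h : ∀ᵐ x ∂(volume.restrict torusCell), p x) : ∀ᵐ x, p x := by
  rw [ae_restrict_iff' measurableSet_torusCell] at h
  have h1 : ∀ m : Fin 2 → ℤ, ∀ᵐ x, (x + fun i => (m i : ℝ) * (2 * π)) ∈ torusCell →
      p (x + fun i => (m i : ℝ) * (2 * π)) := fun m =>
    (measurePreserving_add_right volume _).quasiMeasurePreserving.ae h
  filter_upwards [ae_all_iff.2 h1] with x hx
  obtain ⟨m, hm⟩ := exists_add_int_mem_torusCell x
  have := hx m hm
  rwa [hp.add_int] at this

section TrigSeries

variable {c : (Fin 2 → ℤ) → ℂ}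

theorem summable_mul_torusExp (hc : Summable fun k => ‖c k‖) (x : Fin 2 → ℝ) :
    Summable fun k => c k * torusExp k x := by
  refine Summable.of_norm ?_
  simpa using hc

theorem continuous_trigSeries (hc : Summable fun k => ‖c k‖) :
    Continuous fun x => ∑' k, c k * torusExp k x :=
  continuous_tsum (fun k => continuous_const.mul (continuous_torusExp k)) hc (fun k x => by simp)

theorem cellPeriodic_trigSeries : CellPeriodic fun x => ∑' k, c k * torusExp k x :=
  fun i x => by simp only [cellPeriodic_torusExp _ i x]

theorem norm_trigSeries_le (hc : Summable fun k => ‖c k‖) (x : Fin 2 → ℝ) :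
    ‖∑' k, c k * torusExp k x‖ ≤ ∑' k, ‖c k‖ := by
  have h : (fun k => ‖c k * torusExp k x‖) = fun k => ‖c k‖ := by simp
  refine (norm_tsum_le_tsum_norm ?_).trans_eq (by rw [h])
  rwa [h]

/-- Multiplication of an integrable function by an absolutely convergent trigonometric series
convolves the Fourier coefficients. -/
theorem hasSum_fourierCoeffC_trigSeries_mul (hc : Summable fun k => ‖c k‖)
    {G : (Fin 2 → ℝ) → ℂ} (hG : IntegrableOn G torusCell) (k : Fin 2 → ℤ) :
    HasSum (fun j => c j * fourierCoeffC G (k - j))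
      (fourierCoeffC (fun x => (∑' j, c j * torusExp j x) * G x) k) := by
  have h1 : ∀ j, Integrable (fun x => c j * (G x * torusExp (-(k - j)) x))
      (volume.restrict torusCell) := fun j => (integrableOn_mul_torusExp hG _).const_mul _
  have h2 : ∀ j, ∫ x in torusCell, ‖c j * (G x * torusExp (-(k - j)) x)‖
      = ‖c j‖ * ∫ x in torusCell, ‖G x‖ := by
    intro j
    simp only [norm_mul, norm_torusExp, mul_one]
    exact integral_const_mul _ _
  have h3 := hasSum_integral_of_summable_integral_norm h1 (by
    simp only [h2]; exact hc.mul_right _)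
  have h4 : ∀ x, ∑' j, c j * (G x * torusExp (-(k - j)) x)
      = (∑' j, c j * torusExp j x) * G x * torusExp (-k) x := by
    intro x
    rw [mul_assoc, ← tsum_mul_right]
    refine tsum_congr fun j => ?_
    rw [neg_sub, sub_eq_add_neg, torusExp_add]
    ring
  simp only [h4] at h3
  have h5 := h3.const_smul (((2 * π : ℝ) ^ 2)⁻¹)
  convert! h5 using 1
  ext j
  rw [integral_const_mul, fourierCoeffC, mul_smul_comm]

theorem fourierCoeffC_trigSeries (hc : Summable fun k => ‖c k‖) (k : Fin 2 → ℤ) :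
    fourierCoeffC (fun x => ∑' j, c j * torusExp j x) k = c k := by
  have h := hasSum_fourierCoeffC_trigSeries_mul hc (G := torusExp 0)
    (integrableOn_cell_of_continuous (continuous_torusExp 0)) k
  simp only [torusExp_zero, mul_one, fourierCoeffC_torusExp] at h
  refine h.unique ?_
  convert! hasSum_single k (f := fun j => c j * if 0 = k - j then 1 else 0) ?_ using 1
  · simp
  · intro j hj
    simp [(sub_ne_zero.2 hj.symm).symm]

theorem memLp_cell_of_continuous {F : (Fin 2 → ℝ) → ℂ} (hF : Continuous F) (p : ENNReal) :
    MemLp F p (volume.restrict torusCell) := by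
  obtain ⟨C, hC⟩ := isCompact_torusCell.exists_bound_of_continuousOn hF.continuousOn
  refine MemLp.of_bound hF.aestronglyMeasurable C ?_
  rw [ae_restrict_iff' measurableSet_torusCell]
  exact Eventually.of_forall hC

/-- A square-integrable function with absolutely summable Fourier coefficients is almost everywhere
the sum of its Fourier series. -/
theorem ae_eq_trigSeries {F : (Fin 2 → ℝ) → ℂ} (hper : CellPeriodic F)
    (hF : MemLp F 2 (volume.restrict torusCell)) (hs : Summable fun k => ‖fourierCoeffC F k‖) :
    F =ᵐ[volume] fun x => ∑' k, fourierCoeffC F k * torusExp k x := by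
  refine ae_of_ae_cell (fun i x => ?_) (ae_eq_of_fourierCoeffC_eq hF
    (memLp_cell_of_continuous (continuous_trigSeries hs) 2)
    fun k => (fourierCoeffC_trigSeries hs k).symm)
  simp only [hper i x, cellPeriodic_torusExp _ i x]

theorem eq_trigSeries_of_continuous {F : (Fin 2 → ℝ) → ℂ} (hper : CellPeriodic F)
    (hF : Continuous F) (hs : Summable fun k => ‖fourierCoeffC F k‖) (x : Fin 2 → ℝ) :
    F x = ∑' k, fourierCoeffC F k * torusExp k x :=
  congrFun ((hF.ae_eq_iff_eq volume (continuous_trigSeries hs)).1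
    (ae_eq_trigSeries hper (memLp_cell_of_continuous hF 2) hs)) x

end TrigSeries

/-! ### The trilinear estimate on the Fourier side -/

/-- The Japanese bracket `⟨k⟩ = (1 + |k|²)^{1/2}` of a frequency. -/
noncomputable def bracket (k : Fin 2 → ℤ) : ℝ := √(1 + ∑ i, (k i : ℝ) ^ 2)

/-- The planar cross product `k₀ l₁ - k₁ l₀`. -/
def cross (k l : Fin 2 → ℤ) : ℝ := k 0 * l 1 - k 1 * l 0

theorem bracket_sq (k : Fin 2 → ℤ) : bracket k ^ 2 = 1 + ∑ i, (k i : ℝ) ^ 2 :=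
  Real.sq_sqrt (by positivity)

theorem one_le_bracket (k : Fin 2 → ℤ) : 1 ≤ bracket k := by
  rw [bracket, Real.one_le_sqrt]
  have : 0 ≤ ∑ i, (k i : ℝ) ^ 2 := by positivity
  linarith

theorem bracket_pos (k : Fin 2 → ℤ) : 0 < bracket k := zero_lt_one.trans_le (one_le_bracket k)

theorem bracket_neg (k : Fin 2 → ℤ) : bracket (-k) = bracket k := by simp [bracket]

theorem abs_coord_le_bracket (k : Fin 2 → ℤ) (i : Fin 2) : |(k i : ℝ)| ≤ bracket k := by
  refine Real.abs_le_sqrt ?_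
  have := Finset.single_le_sum (f := fun i => (k i : ℝ) ^ 2) (fun i _ => sq_nonneg _)
    (Finset.mem_univ i)
  linarith

theorem bracket_rpow_two_mul (k : Fin 2 → ℤ) (s : ℝ) :
    bracket k ^ (2 * s) = (1 + ∑ i, (k i : ℝ) ^ 2) ^ s := by
  rw [Real.rpow_mul (bracket_pos k).le, Real.rpow_two, bracket_sq]

theorem bracket_rpow_sq (k : Fin 2 → ℤ) (s : ℝ) :
    (bracket k ^ s) ^ 2 = (1 + ∑ i, (k i : ℝ) ^ 2) ^ s := by
  rw [← bracket_rpow_two_mul, ← Real.rpow_natCast, ← Real.rpow_mul (bracket_pos k).le]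
  congr 1
  push_cast
  ring

theorem bracket_add_le (k l : Fin 2 → ℤ) : bracket (k + l) ≤ bracket k + bracket l := by
  refine Real.sqrt_le_iff.2 ⟨by linarith [bracket_pos k, bracket_pos l], ?_⟩
  have h : (∑ i, (k i : ℝ) * l i) ≤ bracket k * bracket l := by
    rw [bracket, bracket, ← Real.sqrt_mul (by positivity)]
    refine Real.le_sqrt_of_sq_le ?_
    simp only [Fin.sum_univ_two]
    nlinarith [sq_nonneg ((k 0 : ℝ) * l 1 - k 1 * l 0)]
  rw [add_sq, bracket_sq, bracket_sq]
  simp only [Fin.sum_univ_two, Pi.add_apply] at h ⊢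
  push_cast
  nlinarith

theorem bracket_le_add (k l : Fin 2 → ℤ) : bracket k ≤ bracket l + bracket (k - l) := by
  simpa using bracket_add_le l (k - l)

theorem bracket_sub_comm (k l : Fin 2 → ℤ) : bracket (k - l) = bracket (l - k) := by
  rw [← bracket_neg, neg_sub]

theorem bracket_le_two_mul (k l : Fin 2 → ℤ) : bracket k ≤ 2 * (bracket (k - l) * bracket l) := by
  nlinarith [bracket_le_add k l, one_le_bracket l, one_le_bracket (k - l)]

theorem abs_cross_le (k l : Fin 2 → ℤ) : |cross k l| ≤ bracket k * bracket l := by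
  rw [bracket, bracket, ← Real.sqrt_mul (by positivity)]
  refine Real.abs_le_sqrt ?_
  simp only [Fin.sum_univ_two, cross]
  nlinarith [sq_nonneg ((k 0 : ℝ) * l 0 + k 1 * l 1)]

theorem cross_sub_left (k l : Fin 2 → ℤ) : cross (k - l) l = cross k l := by
  simp [cross]; ring

theorem cross_swap (k l : Fin 2 → ℤ) : cross l k = -cross k l := by
  simp [cross]; ring

theorem abs_cross_le_sub_right (k l : Fin 2 → ℤ) : |cross k l| ≤ bracket (k - l) * bracket l := by
  rw [← cross_sub_left]; exact abs_cross_le _ _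

theorem abs_cross_le_sub_left (k l : Fin 2 → ℤ) : |cross k l| ≤ bracket (k - l) * bracket k := by
  rw [bracket_sub_comm, ← abs_neg, ← cross_swap]; exact abs_cross_le_sub_right _ _

/-- In dimension two, `∑ ⟨k⟩^{-2s}` converges for `s > 1`. -/
theorem summable_bracket_rpow_neg {s : ℝ} (hs : 1 < s) :
    Summable fun k : Fin 2 → ℤ => bracket k ^ (-(2 * s)) := by
  refine Summable.of_norm_bounded_eventually
    (EisensteinSeries.summable_one_div_norm_rpow (k := 2 * s) (by linarith)) ?_
  filter_upwards [(finite_singleton (0 : Fin 2 → ℤ)).compl_mem_cofinite] with k hk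
  have hk' : 0 < ‖k‖ := norm_pos_iff.2 hk
  rw [Real.norm_of_nonneg (by have := bracket_pos k; positivity)]
  refine Real.rpow_le_rpow_of_nonpos hk' ?_ (by linarith)
  refine (pi_norm_le_iff_of_nonneg (bracket_pos k).le).2 fun i => ?_
  rw [Int.norm_eq_abs]
  exact abs_coord_le_bracket k i

/-- The constant `(∑ ⟨k⟩^{-2s})^{1/2}` of the embedding of `H^s` into the absolutely convergent
Fourier series. -/
noncomputable def embeddingConst (s : ℝ) : ℝ := √(∑' k : Fin 2 → ℤ, bracket k ^ (-(2 * s)))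

section CauchySchwarz

variable {ι : Type*} {f g : ι → ℝ}

theorem summable_mul_of_sq (hf : ∀ i, 0 ≤ f i) (hg : ∀ i, 0 ≤ g i)
    (hf2 : Summable fun i => f i ^ 2) (hg2 : Summable fun i => g i ^ 2) :
    Summable (fun i => f i * g i) ∧
      ∑' i, f i * g i ≤ √(∑' i, f i ^ 2) * √(∑' i, g i ^ 2) := by
  have h := Real.summable_and_inner_le_Lp_mul_Lq_tsum_of_nonneg (p := 2) (q := 2)
    Real.HolderConjugate.two_two hf hg (by simpa using hf2) (by simpa using hg2)
  simpa [Real.sqrt_eq_rpow] using h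

end CauchySchwarz

/-- Functions with finite `H^s` norm have absolutely summable Fourier coefficients. -/
theorem summable_of_weighted_sq {s : ℝ} (hs : 1 < s) {a : (Fin 2 → ℤ) → ℝ} (ha : ∀ k, 0 ≤ a k)
    (hsum : Summable fun k => (bracket k ^ s * a k) ^ 2) :
    Summable a ∧ ∑' k, a k ≤ embeddingConst s * √(∑' k, (bracket k ^ s * a k) ^ 2) := by
  have h1 : ∀ k : Fin 2 → ℤ, (bracket k ^ (-s)) ^ 2 = bracket k ^ (-(2 * s)) := by
    intro k
    rw [← Real.rpow_natCast, ← Real.rpow_mul (bracket_pos k).le]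
    congr 1
    push_cast
    ring
  have h2 : ∀ k : Fin 2 → ℤ, bracket k ^ (-s) * (bracket k ^ s * a k) = a k := by
    intro k
    rw [← mul_assoc, ← Real.rpow_add (bracket_pos k)]
    simp
  have h := summable_mul_of_sq (f := fun k : Fin 2 → ℤ => bracket k ^ (-s))
    (g := fun k => bracket k ^ s * a k)
    (fun k => by have := bracket_pos k; positivity)
    (fun k => by have := bracket_pos k; have := ha k; positivity)
    (by simp only [h1]; exact summable_bracket_rpow_neg hs) hsum
  simp only [h1, h2] at h
  exact h

/-- A discrete form of Young's inequality `‖f‖₁ ‖g‖₂ ‖h‖₂`, in which the indices of the two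
square-summable factors are related by permutations. -/
theorem summable_mul_mul_perm {ι : Type*} {f g h : ι → ℝ} (hf : ∀ i, 0 ≤ f i) (hg : ∀ i, 0 ≤ g i)
    (hh : ∀ i, 0 ≤ h i) (hf1 : Summable f) (hg2 : Summable fun i => g i ^ 2)
    (hh2 : Summable fun i => h i ^ 2) (σ : ι → Equiv.Perm ι) :
    Summable (fun q : ι × ι => f q.1 * (g q.2 * h (σ q.1 q.2))) ∧
      ∑' q : ι × ι, f q.1 * (g q.2 * h (σ q.1 q.2))
        ≤ (∑' i, f i) * (√(∑' i, g i ^ 2) * √(∑' i, h i ^ 2)) := by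
  have h1 : ∀ x, Summable (fun y => g y * h (σ x y)) ∧
      ∑' y, g y * h (σ x y) ≤ √(∑' i, g i ^ 2) * √(∑' i, h i ^ 2) := by
    intro x
    have e1 : Summable fun y => h (σ x y) ^ 2 := (σ x).summable_iff.2 hh2
    have e2 : ∑' y, h (σ x y) ^ 2 = ∑' i, h i ^ 2 := (σ x).tsum_eq (fun i => h i ^ 2)
    rw [← e2]
    exact summable_mul_of_sq hg (fun y => hh _) hg2 e1
  have h2 : ∀ x, ∑' y, f x * (g y * h (σ x y))
      ≤ f x * (√(∑' i, g i ^ 2) * √(∑' i, h i ^ 2)) := fun x => by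
    rw [tsum_mul_left]; exact mul_le_mul_of_nonneg_left (h1 x).2 (hf x)
  have h3 : ∀ x, 0 ≤ ∑' y, f x * (g y * h (σ x y)) := fun x =>
    tsum_nonneg fun y => mul_nonneg (hf x) (mul_nonneg (hg y) (hh _))
  have h4 : Summable fun x => ∑' y, f x * (g y * h (σ x y)) :=
    Summable.of_nonneg_of_le h3 h2 (hf1.mul_right _)
  have h5 : Summable (fun q : ι × ι => f q.1 * (g q.2 * h (σ q.1 q.2))) := by
    have h6 : 0 ≤ fun q : ι × ι => f q.1 * (g q.2 * h (σ q.1 q.2)) :=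
      fun q => mul_nonneg (hf _) (mul_nonneg (hg _) (hh _))
    have h7 : ∀ x, Summable fun y => f x * (g y * h (σ x y)) := fun x => (h1 x).1.mul_left _
    exact (summable_prod_of_nonneg h6).2 ⟨h7, h4⟩
  refine ⟨h5, ?_⟩
  rw [h5.tsum_prod, ← tsum_mul_right]
  exact h4.tsum_le_tsum h2 (hf1.mul_right _)

/-- The commutator estimate on frequencies `y ≤ x ≤ y + z`. If `z ≤ y`, then `x` and `y` are
comparable and the difference of the weights gains one power; otherwise `x ≤ 2z`. -/
theorem rpow_sub_rpow_mul_le {s x y z : ℝ} (hs : 1 ≤ s) (hy : 1 ≤ y) (hz : 1 ≤ z)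
    (hyx : y ≤ x) (hxz : x ≤ y + z) :
    (x ^ (2 * s) - y ^ (2 * s)) * (z * y)
      ≤ 2 * s * 2 ^ s * (z ^ 2 * (x ^ s * y ^ s) + z ^ (s + 2) * x ^ s) := by
  have hx : 1 ≤ x := hy.trans hyx
  have hx0 : 0 < x := by linarith
  have hy0 : 0 < y := by linarith
  have hz0 : 0 < z := by linarith
  have h2s : (1 : ℝ) ≤ 2 ^ s := Real.one_le_rpow (by norm_num) (by linarith)
  have e1 : x ^ (2 * s) = x ^ s * (x ^ (s - 1) * x) := by
    rw [← Real.rpow_add_one hx0.ne', ← Real.rpow_add hx0]; congr 1; ring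
  by_cases hzy : z ≤ y
  · have hd : x ^ (2 * s) - y ^ (2 * s) ≤ 2 * s * (x ^ s * x ^ (s - 1)) * z := by
      have hb := one_add_mul_self_le_rpow_one_add (s := y / x - 1) (p := 2 * s)
        (by have : 0 ≤ y / x := by positivity
            linarith) (by linarith)
      rw [add_sub_cancel, Real.div_rpow hy0.le hx0.le, le_div_iff₀ (by positivity)] at hb
      have e2 : (1 + 2 * s * (y / x - 1)) * x ^ (2 * s)
          = x ^ (2 * s) - 2 * s * (x ^ s * x ^ (s - 1)) * (x - y) := by
        rw [e1]; field_simp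
        ring
      rw [e2] at hb
      have : 2 * s * (x ^ s * x ^ (s - 1)) * (x - y) ≤ 2 * s * (x ^ s * x ^ (s - 1)) * z :=
        mul_le_mul_of_nonneg_left (by linarith) (by positivity)
      linarith
    have hxy : x ^ (s - 1) ≤ 2 ^ s * y ^ (s - 1) := by
      calc x ^ (s - 1) ≤ (2 * y) ^ (s - 1) :=
            Real.rpow_le_rpow hx0.le (by linarith) (by linarith)
        _ = 2 ^ (s - 1) * y ^ (s - 1) := Real.mul_rpow (by norm_num) hy0.le
        _ ≤ 2 ^ s * y ^ (s - 1) := by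
            gcongr
            · norm_num
            · linarith
    calc (x ^ (2 * s) - y ^ (2 * s)) * (z * y)
        ≤ (2 * s * (x ^ s * x ^ (s - 1)) * z) * (z * y) := by gcongr
      _ ≤ (2 * s * (x ^ s * (2 ^ s * y ^ (s - 1))) * z) * (z * y) := by gcongr
      _ = 2 * s * 2 ^ s * (z ^ 2 * (x ^ s * (y ^ (s - 1) * y))) := by ring
      _ = 2 * s * 2 ^ s * (z ^ 2 * (x ^ s * y ^ s)) := by
          rw [← Real.rpow_add_one hy0.ne', sub_add_cancel]
      _ ≤ _ := by
          gcongr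
          have : 0 ≤ z ^ (s + 2) * x ^ s := by positivity
          linarith
  · have hxs : x ^ s ≤ 2 ^ s * z ^ s := by
      rw [← Real.mul_rpow (by norm_num) hz0.le]
      exact Real.rpow_le_rpow hx0.le (by linarith) (by linarith)
    have e3 : x ^ (2 * s) = x ^ s * x ^ s := by rw [← Real.rpow_add hx0]; congr 1; ring
    have e4 : z ^ (s + 2) = z ^ s * z ^ 2 := by
      rw [Real.rpow_add hz0]; norm_cast
    calc (x ^ (2 * s) - y ^ (2 * s)) * (z * y) ≤ x ^ (2 * s) * (z * z) := by
          have : 0 ≤ y ^ (2 * s) := by positivity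
          gcongr
          · linarith
          · linarith
      _ = x ^ s * x ^ s * z ^ 2 := by rw [e3]; ring
      _ ≤ x ^ s * (2 ^ s * z ^ s) * z ^ 2 := by gcongr
      _ = 1 * 2 ^ s * (z ^ (s + 2) * x ^ s) := by rw [e4]; ring
      _ ≤ 2 * s * 2 ^ s * (z ^ 2 * (x ^ s * y ^ s) + z ^ (s + 2) * x ^ s) := by
          have : 0 ≤ z ^ 2 * (x ^ s * y ^ s) := by positivity
          gcongr
          · linarith
          · linarith

theorem abs_weight_sub_mul_cross_le {s : ℝ} (hs : 1 ≤ s) (k l : Fin 2 → ℤ) :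
    |bracket k ^ (2 * s) - bracket l ^ (2 * s)| * |cross k l|
      ≤ 2 * s * 2 ^ s * (bracket (k - l) ^ 2 * (bracket k ^ s * bracket l ^ s)
        + bracket (k - l) ^ (s + 2) * bracket k ^ s
        + bracket (k - l) ^ (s + 2) * bracket l ^ s) := by
  have hk := one_le_bracket k
  have hl := one_le_bracket l
  have hj := one_le_bracket (k - l)
  have p1 : 0 ≤ 2 * s * 2 ^ s * (bracket (k - l) ^ (s + 2) * bracket l ^ s) := by positivity
  have p2 : 0 ≤ 2 * s * 2 ^ s * (bracket (k - l) ^ (s + 2) * bracket k ^ s) := by positivity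
  rcases le_total (bracket l) (bracket k) with h | h
  · have h1 : bracket l ^ (2 * s) ≤ bracket k ^ (2 * s) :=
      Real.rpow_le_rpow (by linarith) h (by linarith)
    rw [abs_of_nonneg (by linarith)]
    have h2 := rpow_sub_rpow_mul_le hs hl hj h (bracket_le_add k l)
    have h3 := mul_le_mul_of_nonneg_left (abs_cross_le_sub_right k l)
      (show 0 ≤ bracket k ^ (2 * s) - bracket l ^ (2 * s) by linarith)
    linarith
  · have h1 : bracket k ^ (2 * s) ≤ bracket l ^ (2 * s) :=
      Real.rpow_le_rpow (by linarith) h (by linarith)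
    rw [abs_of_nonpos (by linarith)]
    have h2 := rpow_sub_rpow_mul_le hs hk hj h (by
      rw [bracket_sub_comm]; exact bracket_le_add l k)
    have h3 := mul_le_mul_of_nonneg_left (abs_cross_le_sub_left k l)
      (show 0 ≤ bracket l ^ (2 * s) - bracket k ^ (2 * s) by linarith)
    rw [mul_comm (bracket l ^ s)] at h2
    linarith

/-- The constant of the trilinear estimate `trilinear_le`. -/
noncomputable def trilinearConst (s : ℝ) : ℝ := 2 * s * 2 ^ s * (3 * embeddingConst s)

theorem trilinearConst_nonneg {s : ℝ} (hs : 0 ≤ s) : 0 ≤ trilinearConst s := by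
  have : 0 ≤ embeddingConst s := Real.sqrt_nonneg _
  rw [trilinearConst]
  positivity

/-- The trilinear estimate behind the energy inequality: the sum
`∑ |⟨k⟩^{2s} - ⟨l⟩^{2s}| |k × l| p_{k-l} aₖ aₗ` is bounded by `‖p‖_{H^{s+2}} ‖a‖²_{H^s}`. -/
theorem trilinear_le {s : ℝ} (hs : 1 < s) {a p : (Fin 2 → ℤ) → ℝ} (ha : ∀ k, 0 ≤ a k)
    (hp : ∀ k, 0 ≤ p k) (has : Summable fun k => (bracket k ^ s * a k) ^ 2)
    (hps : Summable fun k => (bracket k ^ (s + 2) * p k) ^ 2) :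
    Summable (fun q : (Fin 2 → ℤ) × (Fin 2 → ℤ) =>
      |bracket q.1 ^ (2 * s) - bracket q.2 ^ (2 * s)| * |cross q.1 q.2|
        * (p (q.1 - q.2) * (a q.1 * a q.2))) ∧
    ∑' q : (Fin 2 → ℤ) × (Fin 2 → ℤ),
      |bracket q.1 ^ (2 * s) - bracket q.2 ^ (2 * s)| * |cross q.1 q.2|
        * (p (q.1 - q.2) * (a q.1 * a q.2))
      ≤ trilinearConst s * √(∑' k, (bracket k ^ (s + 2) * p k) ^ 2)
        * ∑' k, (bracket k ^ s * a k) ^ 2 := by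
  set A := ∑' k, (bracket k ^ s * a k) ^ 2 with hA
  set P := ∑' k, (bracket k ^ (s + 2) * p k) ^ 2 with hP
  have hA0 : 0 ≤ A := tsum_nonneg fun k => sq_nonneg _
  have b0 : ∀ k, 0 ≤ bracket k := fun k => (bracket_pos k).le
  have n1 : ∀ k, 0 ≤ bracket k ^ s * a k := fun k => by
    have := b0 k; have := ha k; positivity
  have n2 : ∀ k, 0 ≤ bracket k ^ (s + 2) * p k := fun k => by
    have := b0 k; have := hp k; positivity
  have n3 : ∀ k, 0 ≤ bracket k ^ 2 * p k := fun k => by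
    have := b0 k; have := hp k; positivity
  have e2 : ∀ k, bracket k ^ s * (bracket k ^ 2 * p k) = bracket k ^ (s + 2) * p k := by
    intro k
    rw [Real.rpow_add (bracket_pos k), ← mul_assoc]
    norm_cast
  obtain ⟨s1, t1⟩ := summable_of_weighted_sq hs ha has
  obtain ⟨s2, t2⟩ := summable_of_weighted_sq hs n3 (by simpa only [e2] using hps)
  simp only [e2] at t2
  rw [← hA] at t1
  rw [← hP] at t2
  -- the three arrangements: the absolutely summable factor carries the index `k - l`, `l` or `k`
  let shear : (Fin 2 → ℤ) × (Fin 2 → ℤ) ≃ (Fin 2 → ℤ) × (Fin 2 → ℤ) :=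
    { toFun := fun q => (q.1 - q.2, q.2)
      invFun := fun q => (q.1 + q.2, q.2)
      left_inv := fun q => by simp
      right_inv := fun q => by simp }
  obtain ⟨u1, v1⟩ := summable_mul_mul_perm n3 n1 n1 s2 has has (fun x => Equiv.addLeft x)
  obtain ⟨u2, v2⟩ := summable_mul_mul_perm ha n1 n2 s1 has hps (fun x => Equiv.subRight x)
  obtain ⟨u3, v3⟩ := summable_mul_mul_perm ha n1 n2 s1 has hps (fun x => Equiv.subLeft x)
  rw [← shear.summable_iff] at u1
  rw [← shear.tsum_eq] at v1
  rw [← (Equiv.prodComm _ _).summable_iff] at u2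
  rw [← (Equiv.prodComm _ _).tsum_eq] at v2
  simp only [Function.comp_def, shear, Equiv.coe_fn_mk, Equiv.coe_addLeft, sub_add_cancel,
    Equiv.prodComm_apply, Prod.fst_swap, Prod.snd_swap, Equiv.subRight_apply,
    Equiv.subLeft_apply] at u1 v1 u2 v2 u3 v3
  have hbd : ∀ q : (Fin 2 → ℤ) × (Fin 2 → ℤ),
      |bracket q.1 ^ (2 * s) - bracket q.2 ^ (2 * s)| * |cross q.1 q.2|
        * (p (q.1 - q.2) * (a q.1 * a q.2)) ≤ 2 * s * 2 ^ s *
        ((bracket (q.1 - q.2) ^ 2 * p (q.1 - q.2) * (bracket q.2 ^ s * a q.2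
            * (bracket q.1 ^ s * a q.1))
          + a q.2 * (bracket q.1 ^ s * a q.1 * (bracket (q.1 - q.2) ^ (s + 2) * p (q.1 - q.2))))
          + a q.1 * (bracket q.2 ^ s * a q.2
            * (bracket (q.1 - q.2) ^ (s + 2) * p (q.1 - q.2)))) := by
    intro q
    refine (mul_le_mul_of_nonneg_right (abs_weight_sub_mul_cross_le hs.le q.1 q.2)
      (mul_nonneg (hp _) (mul_nonneg (ha _) (ha _)))).trans_eq ?_
    ring
  have hsum := ((u1.add u2).add u3).mul_left (2 * s * 2 ^ s)
  have hT := Summable.of_nonneg_of_le (fun q => mul_nonneg (by positivity)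
      (mul_nonneg (hp _) (mul_nonneg (ha _) (ha _)))) hbd hsum
  refine ⟨hT, (hT.tsum_le_tsum hbd hsum).trans ?_⟩
  rw [tsum_mul_left, (u1.add u2).tsum_add u3, u1.tsum_add u2, trilinearConst]
  have hsA : √A * √A = A := Real.mul_self_sqrt hA0
  have w1 : (∑' k, bracket k ^ 2 * p k) * (√A * √A) ≤ embeddingConst s * √P * A := by
    rw [hsA]; exact mul_le_mul_of_nonneg_right t2 hA0
  have w2 : (∑' k, a k) * (√A * √P) ≤ embeddingConst s * √P * A := by
    calc (∑' k, a k) * (√A * √P) ≤ (embeddingConst s * √A) * (√A * √P) := by gcongr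
      _ = embeddingConst s * √P * (√A * √A) := by ring
      _ = _ := by rw [hsA]
  calc _ ≤ 2 * s * 2 ^ s * (embeddingConst s * √P * A + embeddingConst s * √P * A
        + embeddingConst s * √P * A) := by
        refine mul_le_mul_of_nonneg_left ?_ (by positivity)
        linarith
    _ = _ := by ring

/-! ### The energy inequality and Young's inequality for sequences -/

/-- The Fourier coefficients of the transport term `J∇ψ·∇f`, for functions `ψ` and `f` with Fourier
coefficients `p` and `a`. -/
noncomputable def transportCoeff (p a : (Fin 2 → ℤ) → ℂ) (k : Fin 2 → ℤ) : ℂ :=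
  ∑' l, (cross k l : ℂ) * p (k - l) * a l

section Sequences

variable {s : ℝ} {p a : (Fin 2 → ℤ) → ℂ}

theorem summable_bracket_sq_mul_norm (hs : 1 < s)
    (hps : Summable fun k => (bracket k ^ (s + 2) * ‖p k‖) ^ 2) :
    Summable (fun k => bracket k ^ 2 * ‖p k‖) ∧
      ∑' k, bracket k ^ 2 * ‖p k‖
        ≤ embeddingConst s * √(∑' k, (bracket k ^ (s + 2) * ‖p k‖) ^ 2) := by
  have e2 : ∀ k, bracket k ^ s * (bracket k ^ 2 * ‖p k‖) = bracket k ^ (s + 2) * ‖p k‖ := by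
    intro k
    rw [Real.rpow_add (bracket_pos k), ← mul_assoc]
    norm_cast
  have h := summable_of_weighted_sq hs (a := fun k => bracket k ^ 2 * ‖p k‖)
    (fun k => by positivity) (by simpa only [e2] using hps)
  simpa only [e2] using h

theorem norm_le_of_weighted_sq (hs : 0 ≤ s)
    (has : Summable fun k => (bracket k ^ s * ‖a k‖) ^ 2) (k : Fin 2 → ℤ) :
    ‖a k‖ ≤ √(∑' k, (bracket k ^ s * ‖a k‖) ^ 2) := by
  refine Real.le_sqrt_of_sq_le (le_trans ?_ (has.le_tsum k fun j _ => sq_nonneg _))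
  have := Real.one_le_rpow (one_le_bracket k) hs
  gcongr
  exact le_mul_of_one_le_left (norm_nonneg _) this

/-- The `H^s` energy inequality on the Fourier side. Since `k × l` is antisymmetric and `ψ` is
real, exchanging `k` and `l` turns the weight `m k` into the difference `m k - m l`, to which the
trilinear estimate applies. The weight only has to be a contraction of `⟨k⟩^{2s}`, so the bound
is uniform in truncations. -/
theorem abs_sum_energy_le (hs : 1 < s) (hconj : ∀ j, p (-j) = (starRingEnd ℂ) (p j))
    (has : Summable fun k => (bracket k ^ s * ‖a k‖) ^ 2)
    (hps : Summable fun k => (bracket k ^ (s + 2) * ‖p k‖) ^ 2)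
    {m : (Fin 2 → ℤ) → ℝ} {S : Finset (Fin 2 → ℤ)} (hS : ∀ k ∉ S, m k = 0 ∨ a k = 0)
    (hm : ∀ k l, |m k - m l| ≤ |bracket k ^ (2 * s) - bracket l ^ (2 * s)|) :
    |∑ k ∈ S, m k * (2 * ((starRingEnd ℂ) (a k) * transportCoeff p a k).re)|
      ≤ trilinearConst s * √(∑' k, (bracket k ^ (s + 2) * ‖p k‖) ^ 2)
        * ∑' k, (bracket k ^ s * ‖a k‖) ^ 2 := by
  obtain ⟨hT, hTle⟩ := trilinear_le hs (fun k => norm_nonneg (a k)) (fun k => norm_nonneg (p k))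
    has hps
  set Q : (Fin 2 → ℤ) × (Fin 2 → ℤ) → ℂ :=
    fun q => (starRingEnd ℂ) (a q.1) * ((cross q.1 q.2 : ℂ) * p (q.1 - q.2) * a q.2) with hQ
  have hQswap : ∀ q, (starRingEnd ℂ) (Q q) = -Q q.swap := by
    intro q
    simp only [hQ, map_mul, Complex.conj_conj, Complex.conj_ofReal, Prod.fst_swap, Prod.snd_swap]
    rw [cross_swap q.1 q.2, ← neg_sub q.1 q.2, hconj]
    push_cast
    ring
  obtain ⟨M, hM⟩ : ∃ M, ∀ l, ‖a l‖ ≤ M := ⟨_, norm_le_of_weighted_sq (by linarith) has⟩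
  have hf := (summable_bracket_sq_mul_norm hs hps).1
  set t : (Fin 2 → ℤ) × (Fin 2 → ℤ) → ℂ := fun q => (m q.1 : ℂ) * Q q with ht
  have htzero : ∀ q, q.1 ∉ S → t q = 0 := by
    intro q hq
    rcases hS _ hq with h | h <;> simp [ht, hQ, h]
  have htsum : Summable t := by
    have hg : Summable fun k => if k ∈ S then |m k| * ‖a k‖ * bracket k * M else 0 :=
      summable_of_ne_finset_zero (s := S) fun k hk => by simp [hk]
    have hM0 : 0 ≤ M := (norm_nonneg _).trans (hM 0)
    have hgf := hg.mul_of_nonneg hf (fun k => by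
      have := (bracket_pos k).le
      dsimp only [Pi.zero_apply]
      split_ifs <;> positivity) (fun k => by
      dsimp only [Pi.zero_apply]; positivity)
    let shear : (Fin 2 → ℤ) × (Fin 2 → ℤ) ≃ (Fin 2 → ℤ) × (Fin 2 → ℤ) :=
      { toFun := fun q => (q.1, q.1 - q.2)
        invFun := fun q => (q.1, q.1 - q.2)
        left_inv := fun q => by simp
        right_inv := fun q => by simp }
    rw [← shear.summable_iff] at hgf
    refine Summable.of_norm_bounded hgf fun q => ?_
    simp only [Function.comp_def, shear, Equiv.coe_fn_mk]
    by_cases hq : q.1 ∈ S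
    · rw [if_pos hq]
      have h1 := abs_cross_le_sub_left q.1 q.2
      have hb := one_le_bracket (q.1 - q.2)
      have hb' := one_le_bracket q.1
      simp only [ht, hQ, norm_mul, Complex.norm_real, Real.norm_eq_abs, RCLike.norm_conj]
      calc |m q.1| * (‖a q.1‖ * (|cross q.1 q.2| * ‖p (q.1 - q.2)‖ * ‖a q.2‖))
          ≤ |m q.1| * (‖a q.1‖ * ((bracket (q.1 - q.2) ^ 2 * bracket q.1)
            * ‖p (q.1 - q.2)‖ * M)) := by
            gcongr
            · refine h1.trans (mul_le_mul_of_nonneg_right ?_ (by linarith))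
              nlinarith
            · exact hM _
        _ = _ := by ring
    · rw [htzero q hq, if_neg hq]
      simp
  have hbound : ∀ q, ‖((m q.1 - m q.2 : ℝ) : ℂ) * Q q‖ ≤
      |bracket q.1 ^ (2 * s) - bracket q.2 ^ (2 * s)| * |cross q.1 q.2|
        * (‖p (q.1 - q.2)‖ * (‖a q.1‖ * ‖a q.2‖)) := by
    intro q
    simp only [hQ, norm_mul, Complex.norm_real, Real.norm_eq_abs, RCLike.norm_conj]
    calc |m q.1 - m q.2| * (‖a q.1‖ * (|cross q.1 q.2| * ‖p (q.1 - q.2)‖ * ‖a q.2‖))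
        ≤ |bracket q.1 ^ (2 * s) - bracket q.2 ^ (2 * s)|
          * (‖a q.1‖ * (|cross q.1 q.2| * ‖p (q.1 - q.2)‖ * ‖a q.2‖)) :=
          mul_le_mul_of_nonneg_right (hm _ _) (by positivity)
      _ = _ := by ring
  have hsumS : ∑' q, t q = ∑ k ∈ S, (m k : ℂ) * ((starRingEnd ℂ) (a k) * transportCoeff p a k) := by
    have h0 : ∀ k ∉ S, ∑' l, t (k, l) = 0 := fun k hk => by
      rw [show (fun l => t (k, l)) = fun _ => 0 from funext fun l => htzero (k, l) hk, tsum_zero]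
    rw [htsum.tsum_prod, tsum_eq_sum (s := S) fun k hk => h0 k hk]
    refine Finset.sum_congr rfl fun k _ => ?_
    simp only [ht, hQ, tsum_mul_left, transportCoeff]
  have hconjsum : Summable fun q => (starRingEnd ℂ) (t q) := by
    refine Summable.of_norm ?_
    simpa using htsum.norm
  have hdiff : ∑' q, ((m q.1 - m q.2 : ℝ) : ℂ) * Q q
      = ((∑ k ∈ S, m k * (2 * ((starRingEnd ℂ) (a k) * transportCoeff p a k).re) : ℝ) : ℂ) := by
    have h1 : ∀ q, (starRingEnd ℂ) (t q.swap) = -((m q.2 : ℂ) * Q q) := by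
      intro q
      simp only [ht, map_mul, Complex.conj_ofReal, hQswap, Prod.fst_swap, Prod.swap_swap]
      ring
    have h2 : ∀ q, ((m q.1 - m q.2 : ℝ) : ℂ) * Q q = t q + (starRingEnd ℂ) (t q.swap) := by
      intro q
      rw [h1]
      simp only [ht]
      push_cast
      ring
    have h3 : Summable fun q : (Fin 2 → ℤ) × (Fin 2 → ℤ) => (starRingEnd ℂ) (t q.swap) :=
      (Equiv.prodComm _ _).summable_iff.2 hconjsum
    have h4 : ∑' q : (Fin 2 → ℤ) × (Fin 2 → ℤ), (starRingEnd ℂ) (t q.swap)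
        = ∑' q, (starRingEnd ℂ) (t q) :=
      (Equiv.prodComm (Fin 2 → ℤ) (Fin 2 → ℤ)).tsum_eq (fun q => (starRingEnd ℂ) (t q))
    simp only [h2]
    rw [htsum.tsum_add h3, h4, ← Complex.conj_tsum, hsumS, Complex.add_conj]
    congr 1
    rw [Complex.re_sum, Finset.mul_sum]
    refine Finset.sum_congr rfl fun k _ => ?_
    rw [Complex.re_ofReal_mul]
    ring
  rw [← Real.norm_eq_abs, ← Complex.norm_real, ← hdiff]
  exact (tsum_of_norm_bounded hT.hasSum hbound).trans hTle

/-- Young's inequality `‖f * h‖₂ ≤ ‖f‖₁ ‖h‖₂` for convolutions on `ℤ²`. -/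
theorem summable_sq_conv {f h : (Fin 2 → ℤ) → ℝ} (hf : ∀ i, 0 ≤ f i) (hh : ∀ i, 0 ≤ h i)
    (hf1 : Summable f) (hh2 : Summable fun i => h i ^ 2) :
    Summable (fun k => (∑' l, f (k - l) * h l) ^ 2) ∧
      ∑' k, (∑' l, f (k - l) * h l) ^ 2 ≤ (∑' i, f i) ^ 2 * ∑' i, h i ^ 2 := by
  set b : (Fin 2 → ℤ) → ℝ := fun k => ∑' l, f (k - l) * h l with hb
  have hb0 : ∀ k, 0 ≤ b k := fun k => tsum_nonneg fun l => mul_nonneg (hf _) (hh _)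
  have hH0 : 0 ≤ ∑' i, h i ^ 2 := tsum_nonneg fun i => sq_nonneg _
  have hfin : ∀ F : Finset (Fin 2 → ℤ), ∑ k ∈ F, b k ^ 2 ≤ (∑' i, f i) ^ 2 * ∑' i, h i ^ 2 := by
    intro F
    set g : (Fin 2 → ℤ) → ℝ := fun k => if k ∈ F then b k else 0 with hg
    have hg0 : ∀ k, 0 ≤ g k := fun k => by simp only [hg]; split_ifs <;> simp [hb0]
    have hgz : ∀ k ∉ F, g k ^ 2 = 0 := fun k hk => by simp [hg, hk]
    have hg2 : ∑' k, g k ^ 2 = ∑ k ∈ F, b k ^ 2 := by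
      rw [tsum_eq_sum hgz]
      exact Finset.sum_congr rfl fun k hk => by simp [hg, hk]
    obtain ⟨u, v⟩ := summable_mul_mul_perm hf hg0 hh hf1 (summable_of_ne_finset_zero hgz) hh2
      (fun x => Equiv.subRight x)
    let shear : (Fin 2 → ℤ) × (Fin 2 → ℤ) ≃ (Fin 2 → ℤ) × (Fin 2 → ℤ) :=
      { toFun := fun q => (q.1 - q.2, q.1)
        invFun := fun q => (q.2, q.2 - q.1)
        left_inv := fun q => by simp
        right_inv := fun q => by simp }
    rw [← shear.summable_iff] at u
    rw [← shear.tsum_eq, hg2] at v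
    simp only [Function.comp_def, shear, Equiv.coe_fn_mk, Equiv.subRight_apply,
      sub_sub_cancel] at u v
    have hsq : ∑' q : (Fin 2 → ℤ) × (Fin 2 → ℤ), f (q.1 - q.2) * (g q.1 * h q.2)
        = ∑ k ∈ F, b k ^ 2 := by
      have e : ∀ k l, f (k - l) * (g k * h l) = g k * (f (k - l) * h l) := fun k l => by ring
      rw [u.tsum_prod]
      simp only [e, tsum_mul_left]
      rw [tsum_eq_sum (s := F) fun k hk => by simp [hg, hk]]
      exact Finset.sum_congr rfl fun k hk => by simp [hg, hk, hb, sq]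
    rw [hsq] at v
    set X := ∑ k ∈ F, b k ^ 2
    have hX0 : 0 ≤ X := Finset.sum_nonneg fun k _ => sq_nonneg _
    have hX : √X * √X = X := Real.mul_self_sqrt hX0
    have hF0 : 0 ≤ ∑' i, f i := tsum_nonneg hf
    have h1 : √X ≤ (∑' i, f i) * √(∑' i, h i ^ 2) := by
      rcases (Real.sqrt_nonneg X).eq_or_lt with h0 | h0
      · rw [← h0]; positivity
      · refine le_of_mul_le_mul_right ?_ h0
        rw [hX]
        linarith
    calc X = √X ^ 2 := by rw [sq, hX]
      _ ≤ ((∑' i, f i) * √(∑' i, h i ^ 2)) ^ 2 := by gcongr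
      _ = _ := by rw [mul_pow, Real.sq_sqrt hH0]
  exact ⟨summable_of_sum_le (fun k => sq_nonneg _) hfin,
    Real.tsum_le_of_sum_le (fun k => sq_nonneg _) hfin⟩

/-- The transport term of `ψ ∈ H^{s+2}` and `f ∈ H^s` lies in `H^1` when `s ≥ 2`. -/
theorem summable_sq_bracket_mul_transportCoeff (hs : 2 ≤ s)
    (has : Summable fun k => (bracket k ^ s * ‖a k‖) ^ 2)
    (hps : Summable fun k => (bracket k ^ (s + 2) * ‖p k‖) ^ 2) :
    Summable (fun k => (bracket k * ‖transportCoeff p a k‖) ^ 2) ∧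
      ∑' k, (bracket k * ‖transportCoeff p a k‖) ^ 2
        ≤ 4 * (embeddingConst s ^ 2 * (∑' k, (bracket k ^ (s + 2) * ‖p k‖) ^ 2)
          * ∑' k, (bracket k ^ s * ‖a k‖) ^ 2) := by
  obtain ⟨hf, hfle⟩ := summable_bracket_sq_mul_norm (by linarith) hps
  set f : (Fin 2 → ℤ) → ℝ := fun k => bracket k ^ 2 * ‖p k‖ with hfdef
  set h : (Fin 2 → ℤ) → ℝ := fun k => bracket k ^ s * ‖a k‖ with hhdef
  have hf0 : ∀ k, 0 ≤ f k := fun k => by positivity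
  have hh0 : ∀ k, 0 ≤ h k := fun k => by have := (bracket_pos k).le; positivity
  obtain ⟨u, v⟩ := summable_sq_conv hf0 hh0 hf has
  have hP0 : 0 ≤ ∑' k, (bracket k ^ (s + 2) * ‖p k‖) ^ 2 := tsum_nonneg fun k => sq_nonneg _
  have hle : ∀ k, (bracket k * ‖transportCoeff p a k‖) ^ 2
      ≤ 4 * (∑' l, f (k - l) * h l) ^ 2 := by
    intro k
    have hsum : Summable fun l => f (k - l) * h l := by
      have hfsh : Summable fun l => f (k - l) := (Equiv.subLeft k).summable_iff.2 hf
      obtain ⟨M, hM⟩ : ∃ M, ∀ l, h l ≤ M := ⟨√(∑' k, h k ^ 2), fun l =>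
        Real.le_sqrt_of_sq_le (has.le_tsum l fun j _ => sq_nonneg _)⟩
      exact Summable.of_nonneg_of_le (fun l => mul_nonneg (hf0 _) (hh0 _))
        (fun l => mul_le_mul_of_nonneg_left (hM l) (hf0 _)) (hfsh.mul_right M)
    have hterm : ∀ l, ‖(cross k l : ℂ) * p (k - l) * a l‖
        ≤ (bracket k)⁻¹ * (2 * (f (k - l) * h l)) := by
      intro l
      have hk := bracket_pos k
      have hl := one_le_bracket l
      have hj := one_le_bracket (k - l)
      rw [inv_mul_eq_div, le_div_iff₀ hk]
      simp only [norm_mul, Complex.norm_real, Real.norm_eq_abs, hfdef, hhdef]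
      have h2 : bracket l ^ 2 ≤ bracket l ^ s := by
        rw [← Real.rpow_natCast]
        exact Real.rpow_le_rpow_of_exponent_le hl (by exact_mod_cast hs)
      calc |cross k l| * ‖p (k - l)‖ * ‖a l‖ * bracket k
          ≤ (bracket (k - l) * bracket l) * ‖p (k - l)‖ * ‖a l‖
            * (2 * (bracket (k - l) * bracket l)) := by
            gcongr
            · exact abs_cross_le_sub_right k l
            · exact bracket_le_two_mul k l
        _ = 2 * (bracket (k - l) ^ 2 * ‖p (k - l)‖ * (bracket l ^ 2 * ‖a l‖)) := by ring
        _ ≤ _ := by gcongr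
    have hnorm := tsum_of_norm_bounded ((hsum.mul_left 2).mul_left (bracket k)⁻¹).hasSum hterm
    rw [tsum_mul_left, tsum_mul_left] at hnorm
    have h3 : bracket k * ‖transportCoeff p a k‖ ≤ 2 * ∑' l, f (k - l) * h l := by
      rw [← le_inv_mul_iff₀ (bracket_pos k)]
      exact hnorm
    calc _ ≤ (2 * ∑' l, f (k - l) * h l) ^ 2 := by
          have := bracket_pos k
          gcongr
      _ = _ := by ring
  have hsum := Summable.of_nonneg_of_le (fun k => sq_nonneg _) hle (u.mul_left 4)
  refine ⟨hsum, (hsum.tsum_le_tsum hle (u.mul_left 4)).trans ?_⟩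
  rw [tsum_mul_left]
  refine mul_le_mul_of_nonneg_left (v.trans ?_) (by norm_num)
  refine mul_le_mul_of_nonneg_right ?_ (tsum_nonneg fun k => sq_nonneg _)
  calc (∑' i, f i) ^ 2 ≤ (embeddingConst s * √(∑' k, (bracket k ^ (s + 2) * ‖p k‖) ^ 2)) ^ 2 := by
        have : 0 ≤ ∑' i, f i := tsum_nonneg hf0
        gcongr
    _ = _ := by rw [mul_pow, Real.sq_sqrt hP0]

end Sequences

/-! ### Sobolev functions, the inverse Laplacian and weak derivatives in Fourier variables -/

theorem integrableOn_ofReal {f : (Fin 2 → ℝ) → ℝ} {S : Set (Fin 2 → ℝ)} (hf : IntegrableOn f S) :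
    IntegrableOn (fun x => (f x : ℂ)) S := hf.ofReal

section SobolevSpace

variable {s : ℝ} {f g : (Fin 2 → ℝ) → ℝ}

theorem sobolevTerm_eq (s : ℝ) (f : (Fin 2 → ℝ) → ℝ) (k : Fin 2 → ℤ) :
    sobolevTerm s f k = (bracket k ^ s * ‖torusFourierCoeff f k‖) ^ 2 := by
  rw [sobolevTerm, mul_pow, bracket_rpow_sq]

theorem sobolevTerm_nonneg (s : ℝ) (f : (Fin 2 → ℝ) → ℝ) (k : Fin 2 → ℤ) :
    0 ≤ sobolevTerm s f k := by
  rw [sobolevTerm_eq]; positivity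

theorem sobolevNorm_eq (s : ℝ) (f : (Fin 2 → ℝ) → ℝ) :
    sobolevNorm s f = √(∑' k, (bracket k ^ s * ‖torusFourierCoeff f k‖) ^ 2) := by
  simp only [sobolevNorm, sobolevTerm_eq]

theorem sobolevNorm_nonneg (s : ℝ) (f : (Fin 2 → ℝ) → ℝ) : 0 ≤ sobolevNorm s f :=
  Real.sqrt_nonneg _

theorem sobolevNorm_sq (s : ℝ) (f : (Fin 2 → ℝ) → ℝ) :
    sobolevNorm s f ^ 2 = ∑' k, (bracket k ^ s * ‖torusFourierCoeff f k‖) ^ 2 := by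
  rw [sobolevNorm_eq, Real.sq_sqrt (tsum_nonneg fun k => sq_nonneg _)]

theorem MemSobolev.summable_sq (hf : MemSobolev s f) :
    Summable fun k => (bracket k ^ s * ‖torusFourierCoeff f k‖) ^ 2 := by
  exact hf.summable.congr fun k => sobolevTerm_eq s f k

theorem MemSobolev.memLp_ofReal (hf : MemSobolev s f) :
    MemLp (fun x => (f x : ℂ)) 2 (volume.restrict torusCell) := hf.memLp.ofReal

theorem MemSobolev.integrableOn (hf : MemSobolev s f) : IntegrableOn f torusCell :=
  hf.memLp.integrable (by simp)

theorem torusFourierCoeff_sub (hf : IntegrableOn f torusCell) (hg : IntegrableOn g torusCell)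
    (k : Fin 2 → ℤ) :
    torusFourierCoeff (fun x => f x - g x) k = torusFourierCoeff f k - torusFourierCoeff g k := by
  simp only [torusFourierCoeff_eq, fourierCoeffC, Complex.ofReal_sub, sub_mul]
  rw [integral_sub (integrableOn_mul_torusExp (integrableOn_ofReal hf) _)
    (integrableOn_mul_torusExp (integrableOn_ofReal hg) _), smul_sub]

theorem torusFourierCoeff_div (f : (Fin 2 → ℝ) → ℝ) (c : ℝ) (k : Fin 2 → ℤ) :
    torusFourierCoeff (fun x => f x / c) k = torusFourierCoeff f k / c := by
  have h : ∀ x, ((f x / c : ℝ) : ℂ) * torusExp (-k) x = (f x : ℂ) * torusExp (-k) x / c := by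
    intro x
    push_cast
    ring
  simp only [torusFourierCoeff_eq, fourierCoeffC, h]
  rw [integral_div, smul_div_assoc]

theorem torusFourierCoeff_congr (h : f =ᵐ[volume] g) (k : Fin 2 → ℤ) :
    torusFourierCoeff f k = torusFourierCoeff g k := by
  rw [torusFourierCoeff, torusFourierCoeff]
  congr 1
  refine integral_congr_ae (ae_restrict_of_ae ?_)
  filter_upwards [h] with x hx
  rw [hx]

theorem torusFourierCoeff_neg (f : (Fin 2 → ℝ) → ℝ) (k : Fin 2 → ℤ) :
    torusFourierCoeff f (-k) = (starRingEnd ℂ) (torusFourierCoeff f k) := by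
  simp only [torusFourierCoeff_eq, fourierCoeffC, Complex.real_smul, map_mul, Complex.conj_ofReal]
  rw [← integral_conj]
  simp [torusExp_neg]

theorem sobolevNorm_congr (h : f =ᵐ[volume] g) (s : ℝ) : sobolevNorm s f = sobolevNorm s g := by
  simp only [sobolevNorm, sobolevTerm, torusFourierCoeff_congr h]

theorem MemSobolev.sub (hf : MemSobolev s f) (hg : MemSobolev s g) :
    MemSobolev s fun x => f x - g x where
  periodic i x := by dsimp only; rw [hf.periodic i x, hg.periodic i x]
  memLp := hf.memLp.sub hg.memLp
  summable := by
    refine Summable.of_nonneg_of_le (sobolevTerm_nonneg s _) (fun k => ?_)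
      ((hf.summable_sq.add hg.summable_sq).mul_left 2)
    rw [sobolevTerm_eq, torusFourierCoeff_sub hf.integrableOn hg.integrableOn]
    have hb : 0 ≤ bracket k ^ s := Real.rpow_nonneg (bracket_pos k).le _
    have h1 := mul_le_mul_of_nonneg_left
      (norm_sub_le (torusFourierCoeff f k) (torusFourierCoeff g k)) hb
    calc _ ≤ (bracket k ^ s * (‖torusFourierCoeff f k‖ + ‖torusFourierCoeff g k‖)) ^ 2 := by
          gcongr
      _ ≤ _ := by
          rw [mul_add]
          nlinarith [sq_nonneg (bracket k ^ s * ‖torusFourierCoeff f k‖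
            - bracket k ^ s * ‖torusFourierCoeff g k‖)]

theorem MemSobolev.div_const (hf : MemSobolev s f) (c : ℝ) : MemSobolev s fun x => f x / c where
  periodic i x := by dsimp only; rw [hf.periodic i x]
  memLp := by simpa only [div_eq_mul_inv] using hf.memLp.mul_const c⁻¹
  summable := by
    refine (hf.summable_sq.mul_right ((‖(c : ℂ)‖⁻¹) ^ 2)).congr fun k => ?_
    rw [sobolevTerm_eq, torusFourierCoeff_div, norm_div]
    ring

theorem MemSobolev.mono {r : ℝ} (hf : MemSobolev s f) (h : r ≤ s) : MemSobolev r f where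
  periodic := hf.periodic
  memLp := hf.memLp
  summable := by
    refine Summable.of_nonneg_of_le (sobolevTerm_nonneg r _) (fun k => ?_) hf.summable_sq
    rw [sobolevTerm_eq]
    have := Real.rpow_le_rpow_of_exponent_le (one_le_bracket k) h
    have hb := bracket_pos k
    gcongr

theorem MemSobolev.norm_coeff_le (hf : MemSobolev s f) (hs : 0 ≤ s) (k : Fin 2 → ℤ) :
    ‖torusFourierCoeff f k‖ ≤ sobolevNorm s f := by
  rw [sobolevNorm_eq]
  exact norm_le_of_weighted_sq hs hf.summable_sq k

theorem sqrt_tsum_sq_le_add {ι : Type*} {x y z : ι → ℝ} (hx : ∀ i, 0 ≤ x i) (hy : ∀ i, 0 ≤ y i)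
    (hz : ∀ i, 0 ≤ z i) (hzxy : ∀ i, z i ≤ x i + y i) (hx2 : Summable fun i => x i ^ 2)
    (hy2 : Summable fun i => y i ^ 2) :
    √(∑' i, z i ^ 2) ≤ √(∑' i, x i ^ 2) + √(∑' i, y i ^ 2) := by
  obtain ⟨u, v⟩ := summable_mul_of_sq hx hy hx2 hy2
  have hs := (hx2.add (u.mul_left 2)).add hy2
  have hle : ∀ i, z i ^ 2 ≤ x i ^ 2 + 2 * (x i * y i) + y i ^ 2 := fun i => by
    calc z i ^ 2 ≤ (x i + y i) ^ 2 := by have := hz i; have := hzxy i; gcongr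
      _ = _ := by ring
  have h1 := (Summable.of_nonneg_of_le (fun i => sq_nonneg _) hle hs).tsum_le_tsum hle hs
  rw [(hx2.add (u.mul_left 2)).tsum_add hy2, hx2.tsum_add (u.mul_left 2), tsum_mul_left] at h1
  refine Real.sqrt_le_iff.2 ⟨by positivity, h1.trans ?_⟩
  rw [add_sq, Real.sq_sqrt (tsum_nonneg fun i => sq_nonneg _),
    Real.sq_sqrt (tsum_nonneg fun i => sq_nonneg _)]
  linarith

theorem sobolevNorm_le_add_sub (hf : MemSobolev s f) (hg : MemSobolev s g) :
    sobolevNorm s f ≤ sobolevNorm s g + sobolevNorm s fun x => f x - g x := by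
  simp only [sobolevNorm_eq]
  have hb : ∀ k, 0 ≤ bracket k ^ s := fun k => Real.rpow_nonneg (bracket_pos k).le _
  refine sqrt_tsum_sq_le_add (fun k => mul_nonneg (hb k) (norm_nonneg _))
    (fun k => mul_nonneg (hb k) (norm_nonneg _)) (fun k => mul_nonneg (hb k) (norm_nonneg _))
    (fun k => ?_) hg.summable_sq (hf.sub hg).summable_sq
  rw [← mul_add, torusFourierCoeff_sub hf.integrableOn hg.integrableOn]
  refine mul_le_mul_of_nonneg_left ?_ (hb k)
  simpa using norm_add_le (torusFourierCoeff g k) (torusFourierCoeff f k - torusFourierCoeff g k)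

theorem sobolevNorm_sub_comm (hf : MemSobolev s f) (hg : MemSobolev s g) :
    (sobolevNorm s fun x => f x - g x) = sobolevNorm s fun x => g x - f x := by
  simp only [sobolevNorm_eq, torusFourierCoeff_sub hf.integrableOn hg.integrableOn,
    torusFourierCoeff_sub hg.integrableOn hf.integrableOn, norm_sub_rev]

theorem abs_sobolevNorm_sub_le (hf : MemSobolev s f) (hg : MemSobolev s g) :
    |sobolevNorm s f - sobolevNorm s g| ≤ sobolevNorm s fun x => f x - g x := by
  rw [abs_sub_le_iff]
  have h1 := sobolevNorm_le_add_sub hf hg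
  have h2 := sobolevNorm_le_add_sub hg hf
  rw [sobolevNorm_sub_comm hg hf] at h2
  constructor <;> linarith

end SobolevSpace

section InverseLaplacian

variable {s : ℝ} {ω ψ : (Fin 2 → ℝ) → ℝ}

theorem fderiv_ofReal_apply {f : (Fin 2 → ℝ) → ℝ} {x : Fin 2 → ℝ} (hf : DifferentiableAt ℝ f x)
    (v : Fin 2 → ℝ) : fderiv ℝ (fun y => (f y : ℂ)) x v = (fderiv ℝ f x v : ℂ) := by
  have := (Complex.ofRealCLM.hasFDerivAt.comp x hf.hasFDerivAt).fderiv
  rw [show (fun y => (f y : ℂ)) = Complex.ofRealCLM ∘ f from rfl, this]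
  simp

theorem contDiff_partialD {n m : WithTop ℕ∞} {f : (Fin 2 → ℝ) → ℝ} (hf : ContDiff ℝ n f)
    (hmn : m + 1 ≤ n) (i : Fin 2) : ContDiff ℝ m (partialD i f) :=
  (hf.fderiv_right hmn).clm_apply contDiff_const

theorem TorusPeriodic.partialD {f : (Fin 2 → ℝ) → ℝ} (hf : TorusPeriodic f) (i : Fin 2) :
    TorusPeriodic (partialD i f) := by
  intro j x
  have h : (fun y => f (y + Pi.single j (2 * π))) = f := funext fun y => hf j y
  rw [_root_.partialD, ← fderiv_comp_add_right, h, _root_.partialD]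

theorem torusFourierCoeff_partialD {f : (Fin 2 → ℝ) → ℝ} (hf : ContDiff ℝ 1 f)
    (hper : TorusPeriodic f) (i : Fin 2) (k : Fin 2 → ℤ) :
    torusFourierCoeff (partialD i f) k = Complex.I * k i * torusFourierCoeff f k := by
  rw [torusFourierCoeff_eq, torusFourierCoeff_eq, ← fourierCoeffC_fderiv (F := fun x => (f x : ℂ))
    (Complex.ofRealCLM.contDiff.comp hf) (fun j x => congrArg Complex.ofReal (hper j x))]
  congr 1
  ext x
  exact (fderiv_ofReal_apply (hf.differentiable (by simp) x) _).symm

theorem IsInvLaplacian.torusFourierCoeff (h : IsInvLaplacian ω ψ) (k : Fin 2 → ℤ) :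
    torusFourierCoeff ω k = -(∑ i, (k i : ℂ) ^ 2) * torusFourierCoeff ψ k := by
  have hc1 : ∀ i, ContDiff ℝ 1 (partialD i ψ) := fun i =>
    contDiff_partialD h.contDiff (by norm_num) i
  have hc0 : ∀ i, Continuous (partialD i (partialD i ψ)) := fun i =>
    (contDiff_partialD (m := 0) (hc1 i) (by norm_num) i).continuous
  have hi : ∀ i, _root_.torusFourierCoeff (partialD i (partialD i ψ)) k
      = -(k i : ℂ) ^ 2 * _root_.torusFourierCoeff ψ k := by
    intro i
    rw [torusFourierCoeff_partialD (hc1 i) (h.periodic.partialD i),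
      torusFourierCoeff_partialD (h.contDiff.of_le (by norm_num)) h.periodic]
    linear_combination (k i : ℂ) ^ 2 * _root_.torusFourierCoeff ψ k * Complex.I_sq
  have hsum : _root_.torusFourierCoeff (fun x => ∑ i, partialD i (partialD i ψ) x) k
      = ∑ i, _root_.torusFourierCoeff (partialD i (partialD i ψ)) k := by
    simp only [torusFourierCoeff_eq, fourierCoeffC, Fin.sum_univ_two, Complex.ofReal_add, add_mul]
    rw [integral_add (integrableOn_mul_torusExp (integrableOn_ofReal (integrableOn_cell_of_continuous (hc0 0))) _)
      (integrableOn_mul_torusExp (integrableOn_ofReal (integrableOn_cell_of_continuous (hc0 1))) _), smul_add]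
  rw [← torusFourierCoeff_congr h.laplacian_eq, hsum]
  simp only [hi, Finset.sum_mul, ← Finset.sum_neg_distrib, neg_mul]

theorem IsInvLaplacian.torusFourierCoeff_zero (h : IsInvLaplacian ω ψ) :
    _root_.torusFourierCoeff ψ 0 = 0 := by
  have := h.meanZero
  rw [MeanZero] at this
  have h0 : ∫ x in torusCell, (ψ x : ℂ) = 0 := by
    rw [integral_complex_ofReal, this, Complex.ofReal_zero]
  simp [_root_.torusFourierCoeff, h0]

/-- `Δ⁻¹` gains two derivatives. -/
theorem IsInvLaplacian.weighted_le (h : IsInvLaplacian ω ψ) (s : ℝ) (k : Fin 2 → ℤ) :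
    (bracket k ^ (s + 2) * ‖_root_.torusFourierCoeff ψ k‖) ^ 2
      ≤ 4 * (bracket k ^ s * ‖_root_.torusFourierCoeff ω k‖) ^ 2 := by
  by_cases hk : k = 0
  · subst hk
    rw [h.torusFourierCoeff_zero, norm_zero, mul_zero, zero_pow two_ne_zero]
    positivity
  · have hn : 1 ≤ ∑ i, (k i : ℝ) ^ 2 := by
      obtain ⟨i, hi⟩ := Function.ne_iff.mp hk
      have h1 : (1 : ℝ) ≤ (k i : ℝ) ^ 2 := by
        have h2 : (0 : ℤ) < k i ^ 2 := by have : k i ≠ 0 := hi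
                                          positivity
        exact_mod_cast h2
      exact h1.trans (Finset.single_le_sum (f := fun i => (k i : ℝ) ^ 2)
        (fun i _ => sq_nonneg _) (Finset.mem_univ i))
    have hnorm : ‖_root_.torusFourierCoeff ω k‖
        = (∑ i, (k i : ℝ) ^ 2) * ‖_root_.torusFourierCoeff ψ k‖ := by
      rw [h.torusFourierCoeff, norm_mul, norm_neg]
      congr 1
      rw [show (∑ i, (k i : ℂ) ^ 2) = ((∑ i, (k i : ℝ) ^ 2 : ℝ) : ℂ) by push_cast; rfl,
        Complex.norm_real, Real.norm_of_nonneg (by positivity)]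
    have hb : bracket k ^ (s + 2) = bracket k ^ s * (1 + ∑ i, (k i : ℝ) ^ 2) := by
      rw [Real.rpow_add (bracket_pos k), Real.rpow_two, bracket_sq]
    have hbs : 0 ≤ bracket k ^ s := Real.rpow_nonneg (bracket_pos k).le _
    rw [hnorm, hb, show (4 : ℝ) = 2 ^ 2 by norm_num, ← mul_pow]
    refine pow_le_pow_left₀ (by positivity) ?_ 2
    calc bracket k ^ s * (1 + ∑ i, (k i : ℝ) ^ 2) * ‖_root_.torusFourierCoeff ψ k‖
        ≤ bracket k ^ s * (2 * ∑ i, (k i : ℝ) ^ 2) * ‖_root_.torusFourierCoeff ψ k‖ := by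
          gcongr
          linarith
      _ = _ := by ring

theorem IsInvLaplacian.summable_sq (h : IsInvLaplacian ω ψ) (hω : MemSobolev s ω) :
    Summable (fun k => (bracket k ^ (s + 2) * ‖_root_.torusFourierCoeff ψ k‖) ^ 2) :=
  Summable.of_nonneg_of_le (fun _ => sq_nonneg _) (h.weighted_le s) (hω.summable_sq.mul_left 4)

theorem IsInvLaplacian.sqrt_tsum_le (h : IsInvLaplacian ω ψ) (hω : MemSobolev s ω) :
    √(∑' k, (bracket k ^ (s + 2) * ‖_root_.torusFourierCoeff ψ k‖) ^ 2) ≤ 2 * sobolevNorm s ω := by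
  refine Real.sqrt_le_iff.2 ⟨by have := sobolevNorm_nonneg s ω; positivity, ?_⟩
  rw [mul_pow, sobolevNorm_sq, ← tsum_mul_left]
  refine ((h.summable_sq hω).tsum_le_tsum (h.weighted_le s) (hω.summable_sq.mul_left 4)).trans_eq ?_
  norm_num

theorem IsInvLaplacian.summable_partialD (hs : 1 < s) (h : IsInvLaplacian ω ψ)
    (hω : MemSobolev s ω) (i : Fin 2) :
    Summable fun k => ‖_root_.torusFourierCoeff (partialD i ψ) k‖ := by
  refine Summable.of_nonneg_of_le (fun k => norm_nonneg _) (fun k => ?_)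
    (summable_bracket_sq_mul_norm hs (h.summable_sq hω)).1
  rw [torusFourierCoeff_partialD (h.contDiff.of_le (by norm_num)) h.periodic]
  simp only [norm_mul, Complex.norm_I, one_mul, Complex.norm_intCast]
  have h1 := abs_coord_le_bracket k i
  have h2 := one_le_bracket k
  gcongr
  nlinarith

theorem IsInvLaplacian.partialD_eq_trigSeries (hs : 1 < s) (h : IsInvLaplacian ω ψ)
    (hω : MemSobolev s ω) (i : Fin 2) (x : Fin 2 → ℝ) :
    (partialD i ψ x : ℂ) = ∑' k, _root_.torusFourierCoeff (partialD i ψ) k * torusExp k x := by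
  have hsum := h.summable_partialD hs hω i
  simp only [torusFourierCoeff_eq] at hsum ⊢
  exact eq_trigSeries_of_continuous (F := fun x => (partialD i ψ x : ℂ))
    (fun j x => congrArg Complex.ofReal (h.periodic.partialD i j x))
    (Complex.continuous_ofReal.comp
      (contDiff_partialD (m := 0) h.contDiff (by norm_num) i).continuous) hsum x

end InverseLaplacian

section WeakPartial

variable {f g : (Fin 2 → ℝ) → ℝ}

theorem HasWeakPartial.torusFourierCoeff {i : Fin 2} (h : HasWeakPartial i f g)
    (hf : IntegrableOn f torusCell) (k : Fin 2 → ℤ) :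
    torusFourierCoeff g k = Complex.I * k i * torusFourierCoeff f k := by
  have hd : ∀ x, fderiv ℝ (torusExp (-k)) x (Pi.single i 1)
      = ((partialD i (fun y => (torusExp (-k) y).re) x : ℝ) : ℂ)
        + ((partialD i (fun y => (torusExp (-k) y).im) x : ℝ) : ℂ) * Complex.I := by
    intro x
    have h0 := (hasFDerivAt_torusExp (-k) x).differentiableAt.hasFDerivAt
    have h1 := (Complex.reCLM.hasFDerivAt.comp x h0).fderiv
    have h2 := (Complex.imCLM.hasFDerivAt.comp x h0).fderiv
    simp only [partialD]
    rw [show (fun y => (torusExp (-k) y).re) = Complex.reCLM ∘ torusExp (-k) from rfl, h1,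
      show (fun y => (torusExp (-k) y).im) = Complex.imCLM ∘ torusExp (-k) from rfl, h2]
    simp [Complex.re_add_im]
  have hre := h.integral_eq (fun y => (torusExp (-k) y).re)
    (Complex.reCLM.contDiff.comp (contDiff_torusExp _))
    (fun j x => congrArg Complex.re (cellPeriodic_torusExp (-k) j x))
  have him := h.integral_eq (fun y => (torusExp (-k) y).im)
    (Complex.imCLM.contDiff.comp (contDiff_torusExp _))
    (fun j x => congrArg Complex.im (cellPeriodic_torusExp (-k) j x))
  have key : ∀ {u : (Fin 2 → ℝ) → ℝ} {v w : (Fin 2 → ℝ) → ℝ}, IntegrableOn u torusCell →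
      Continuous v → Continuous w →
      ∫ x in torusCell, (u x : ℂ) * ((v x : ℂ) + (w x : ℂ) * Complex.I)
        = ((∫ x in torusCell, u x * v x : ℝ) : ℂ)
          + ((∫ x in torusCell, u x * w x : ℝ) : ℂ) * Complex.I := by
    intro u v w hu hv hw
    have hint : ∀ {v : (Fin 2 → ℝ) → ℝ}, Continuous v →
        IntegrableOn (fun x => u x * v x) torusCell := fun hv =>
      hu.mul_continuousOn hv.continuousOn isCompact_torusCell
    rw [← integral_complex_ofReal, ← integral_complex_ofReal, ← integral_mul_const, ← integral_add]
    · refine integral_congr_ae (Eventually.of_forall fun x => ?_)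
      push_cast
      ring
    · exact integrableOn_ofReal (hint hv)
    · exact (integrableOn_ofReal (hint hw)).mul_const _
  have hcont : ∀ (L : ℂ →L[ℝ] ℝ), ContDiff ℝ 1 (fun y => L (torusExp (-k) y)) := fun L =>
    L.contDiff.comp (contDiff_torusExp _)
  have e1 : ∫ x in torusCell, (f x : ℂ) * fderiv ℝ (torusExp (-k)) x (Pi.single i 1)
      = -∫ x in torusCell, (g x : ℂ) * torusExp (-k) x := by
    simp only [hd]
    have hc1 : Continuous (partialD i fun y => (torusExp (-k) y).re) :=
      (contDiff_partialD (m := 0) (hcont Complex.reCLM) (by norm_num) i).continuous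
    have hc2 : Continuous (partialD i fun y => (torusExp (-k) y).im) :=
      (contDiff_partialD (m := 0) (hcont Complex.imCLM) (by norm_num) i).continuous
    rw [key hf hc1 hc2, hre, him]
    have := key h.integrable (hcont Complex.reCLM).continuous (hcont Complex.imCLM).continuous
    simp only [Complex.reCLM_apply, Complex.imCLM_apply, Complex.re_add_im] at this
    rw [this]
    push_cast
    ring
  have e2 : ∀ x, (f x : ℂ) * fderiv ℝ (torusExp (-k)) x (Pi.single i 1)
      = -(Complex.I * k i) * ((f x : ℂ) * torusExp (-k) x) := by
    intro x
    rw [fderiv_torusExp_single]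
    push_cast [Pi.neg_apply]
    ring
  simp only [e2] at e1
  rw [integral_const_mul, neg_mul, neg_inj] at e1
  simp only [torusFourierCoeff_eq, fourierCoeffC]
  rw [← e1, mul_smul_comm]

/-- The Fourier coefficients of the transport term `J∇ψ·∇f`, for a weak gradient of `f`. -/
theorem torusFourierCoeff_transport {s : ℝ} (hs : 1 < s) {ω ψ : (Fin 2 → ℝ) → ℝ}
    (h : IsInvLaplacian ω ψ) (hω : MemSobolev s ω) (hf : IntegrableOn f torusCell)
    {g : Fin 2 → (Fin 2 → ℝ) → ℝ} (hg : ∀ i, HasWeakPartial i f (g i)) (k : Fin 2 → ℤ) :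
    torusFourierCoeff (fun x => ∑ i, symplecticGrad ψ x i * g i x) k
      = transportCoeff (torusFourierCoeff ψ) (torusFourierCoeff f) k := by
  have hprod : ∀ i j, HasSum (fun l => torusFourierCoeff (partialD i ψ) l
        * torusFourierCoeff (g j) (k - l))
      (fourierCoeffC (fun x => (partialD i ψ x : ℂ) * (g j x : ℂ)) k) := by
    intro i j
    have h1 := hasSum_fourierCoeffC_trigSeries_mul (h.summable_partialD hs hω i)
      (integrableOn_ofReal (hg j).integrable) k
    simp only [← h.partialD_eq_trigSeries hs hω i] at h1
    simpa only [torusFourierCoeff_eq (g j)] using h1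
  have hint : ∀ i j, IntegrableOn (fun x => (partialD i ψ x : ℂ) * (g j x : ℂ)) torusCell := by
    intro i j
    refine IntegrableOn.continuousOn_mul ?_ (integrableOn_ofReal (hg j).integrable) isCompact_torusCell
    exact (Complex.continuous_ofReal.comp
      (contDiff_partialD (m := 0) h.contDiff (by norm_num) i).continuous).continuousOn
  have h1 := (hprod 1 0).sub (hprod 0 1)
  have h2 : torusFourierCoeff (fun x => ∑ i, symplecticGrad ψ x i * g i x) k
      = fourierCoeffC (fun x => (partialD 1 ψ x : ℂ) * (g 0 x : ℂ)) k
        - fourierCoeffC (fun x => (partialD 0 ψ x : ℂ) * (g 1 x : ℂ)) k := by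
    rw [torusFourierCoeff_eq, fourierCoeffC, fourierCoeffC, fourierCoeffC, ← smul_sub,
      ← integral_sub (integrableOn_mul_torusExp (hint 1 0) _)
        (integrableOn_mul_torusExp (hint 0 1) _)]
    congr 1
    refine integral_congr_ae (Eventually.of_forall fun x => ?_)
    simp [symplecticGrad, Fin.sum_univ_two]
    ring
  rw [h2, ← h1.tsum_eq, transportCoeff, ← (Equiv.subLeft k).tsum_eq]
  refine tsum_congr fun l => ?_
  have hψ1 : ContDiff ℝ 1 ψ := h.contDiff.of_le (by norm_num)
  simp only [Equiv.subLeft_apply, sub_sub_cancel, (hg _).torusFourierCoeff hf,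
    torusFourierCoeff_partialD hψ1 h.periodic]
  simp only [cross, Pi.sub_apply]
  push_cast
  linear_combination (((k 0 - l 0) * l 1 - (k 1 - l 1) * l 0 : ℂ) * torusFourierCoeff ψ (k - l)
    * torusFourierCoeff f l) * (- Complex.I_sq)

end WeakPartial

/-! ### The Euler equation -/

/-- The box of frequencies `k` with `|k₀|, |k₁| ≤ N`. -/
noncomputable def freqBox (N : ℕ) : Finset (Fin 2 → ℤ) := Finset.Icc (fun _ => -(N : ℤ)) (fun _ => (N : ℤ))

theorem mem_freqBox {N : ℕ} {k : Fin 2 → ℤ} : k ∈ freqBox N ↔ ∀ i, |k i| ≤ N := by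
  simp only [freqBox, Finset.mem_Icc, Pi.le_def, abs_le, forall_and]

theorem mem_freqBox_of_bracket_le {N : ℕ} {k : Fin 2 → ℤ} (h : bracket k ≤ N) : k ∈ freqBox N :=
  mem_freqBox.2 fun i => by exact_mod_cast (abs_coord_le_bracket k i).trans h

theorem lt_bracket_of_notMem_freqBox {N : ℕ} {k : Fin 2 → ℤ} (h : k ∉ freqBox N) :
    (N : ℝ) < bracket k :=
  lt_of_not_ge fun h' => h (mem_freqBox_of_bracket_le h')

/-- The weight `⟨k⟩^{2s}` cut off by a tent: it agrees with `⟨k⟩^{2s}` up to the value `N`, has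
finite support, and is a `1`-Lipschitz function of `⟨k⟩^{2s}`. -/
noncomputable def tentWeight (s : ℝ) (N : ℕ) (k : Fin 2 → ℤ) : ℝ :=
  max 0 (min (bracket k ^ (2 * s)) (2 * N - bracket k ^ (2 * s)))

theorem tentWeight_nonneg (s : ℝ) (N : ℕ) (k : Fin 2 → ℤ) : 0 ≤ tentWeight s N k := le_max_left _ _

theorem tentWeight_le (s : ℝ) (N : ℕ) (k : Fin 2 → ℤ) : tentWeight s N k ≤ bracket k ^ (2 * s) :=
  max_le (Real.rpow_nonneg (bracket_pos k).le _) (min_le_left _ _)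

theorem tentWeight_eq {s : ℝ} {N : ℕ} {k : Fin 2 → ℤ} (h : bracket k ^ (2 * s) ≤ N) :
    tentWeight s N k = bracket k ^ (2 * s) := by
  rw [tentWeight, min_eq_left (by linarith),
    max_eq_right (Real.rpow_nonneg (bracket_pos k).le _)]

theorem tentWeight_eq_zero {s : ℝ} (hs : 1 ≤ s) {N : ℕ} {k : Fin 2 → ℤ}
    (h : k ∉ freqBox (2 * N)) : tentWeight s N k = 0 := by
  have h1 := lt_bracket_of_notMem_freqBox h
  have h2 : bracket k ≤ bracket k ^ (2 * s) := by
    simpa using Real.rpow_le_rpow_of_exponent_le (one_le_bracket k) (show 1 ≤ 2 * s by linarith)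
  push_cast at h1
  exact max_eq_left ((min_le_right _ _).trans (by linarith))

theorem abs_tentWeight_sub_le (s : ℝ) (N : ℕ) (k l : Fin 2 → ℤ) :
    |tentWeight s N k - tentWeight s N l| ≤ |bracket k ^ (2 * s) - bracket l ^ (2 * s)| := by
  refine (abs_max_sub_max_le_max _ _ _ _).trans (max_le (by simp) ?_)
  refine (abs_min_sub_min_le_max _ _ _ _).trans (max_le le_rfl ?_)
  rw [sub_sub_sub_cancel_left, abs_sub_comm]

theorem hasDerivWithinAt_norm_sq {a : ℝ → ℂ} {a' : ℂ} {S : Set ℝ} {t : ℝ}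
    (h : HasDerivWithinAt a a' S t) :
    HasDerivWithinAt (fun r => ‖a r‖ ^ 2) (2 * ((starRingEnd ℂ) (a t) * a').re) S t := by
  have := h.norm_sq
  rwa [Complex.inner, mul_comm a'] at this

section Euler

variable {s : ℝ} {ω₀ : (Fin 2 → ℝ) → ℝ} {ω : ℝ → (Fin 2 → ℝ) → ℝ}

/-- The Fourier coefficients of a solution of the Euler equation satisfy the equation in Fourier
variables. -/
theorem IsEulerSolution.hasDerivWithinAt_coeff (hs : 2 ≤ s) (h : IsEulerSolution s ω₀ ω) {t : ℝ}
    (ht : 0 ≤ t) : ∃ ψ, IsInvLaplacian (ω t) ψ ∧ ∀ k,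
      HasDerivWithinAt (fun r => torusFourierCoeff (ω r) k)
        (transportCoeff (torusFourierCoeff ψ) (torusFourierCoeff (ω t)) k) (Ici 0) t := by
  obtain ⟨ω', hmem', -, hderiv, heq⟩ := h.equation
  obtain ⟨ψ, g, hψ, hg, hae⟩ := heq t ht
  refine ⟨ψ, hψ, fun k => ?_⟩
  have hcoeff : torusFourierCoeff (ω' t) k
      = transportCoeff (torusFourierCoeff ψ) (torusFourierCoeff (ω t)) k := by
    rw [← torusFourierCoeff_transport (by linarith) hψ (h.mem t ht) (h.mem t ht).integrableOn hg]
    refine torusFourierCoeff_congr ?_ k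
    filter_upwards [hae] with x hx
    exact sub_eq_zero.1 hx
  rw [← hcoeff, hasDerivWithinAt_iff_tendsto_slope, tendsto_iff_norm_sub_tendsto_zero]
  refine squeeze_zero' (Eventually.of_forall fun r => norm_nonneg _) ?_ (hderiv t ht)
  filter_upwards [self_mem_nhdsWithin] with r hr
  have hr0 : 0 ≤ r := hr.1
  have hquot : MemSobolev (s - 1) fun x => (ω r x - ω t x) / (r - t) :=
    (((h.mem r hr0).sub (h.mem t ht)).div_const (r - t)).mono (by linarith)
  have hle := (hquot.sub (hmem' t ht)).norm_coeff_le (by linarith) k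
  rw [torusFourierCoeff_sub hquot.integrableOn (hmem' t ht).integrableOn, torusFourierCoeff_div,
    torusFourierCoeff_sub (h.mem r hr0).integrableOn (h.mem t ht).integrableOn] at hle
  refine le_of_eq_of_le ?_ hle
  rw [slope_def_module, Complex.real_smul, Complex.ofReal_inv, Complex.ofReal_sub, inv_mul_eq_div]

/-- The growth of the squared `H^s` norm of a solution of the Euler equation is at most cubic. -/
theorem IsEulerSolution.sobolevNorm_sq_sub_le (hs : 2 ≤ s) (h : IsEulerSolution s ω₀ ω)
    {a b D : ℝ} (ha : 0 ≤ a) (hab : a ≤ b) (hD : ∀ r ∈ Icc a b, sobolevNorm s (ω r) ≤ D) :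
    sobolevNorm s (ω b) ^ 2 - sobolevNorm s (ω a) ^ 2
      ≤ trilinearConst s * (2 * D) * D ^ 2 * (b - a) := by
  have hb : 0 ≤ b := ha.trans hab
  have hC := trilinearConst_nonneg (show 0 ≤ s by linarith)
  -- the tent-weighted energies are finite sums, so they can be differentiated termwise
  have htent : ∀ N, ∑ k ∈ freqBox (2 * N), tentWeight s N k * ‖torusFourierCoeff (ω b) k‖ ^ 2
      - ∑ k ∈ freqBox (2 * N), tentWeight s N k * ‖torusFourierCoeff (ω a) k‖ ^ 2
      ≤ trilinearConst s * (2 * D) * D ^ 2 * (b - a) := by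
    intro N
    set E : ℝ → ℝ := fun r =>
      ∑ k ∈ freqBox (2 * N), tentWeight s N k * ‖torusFourierCoeff (ω r) k‖ ^ 2 with hE
    have hder : ∀ r ∈ Icc a b, ∃ E', HasDerivWithinAt E E' (Ici 0) r ∧
        E' ≤ trilinearConst s * (2 * D) * D ^ 2 := by
      intro r hr
      have hr0 : 0 ≤ r := ha.trans hr.1
      obtain ⟨ψ, hψ, hd⟩ := h.hasDerivWithinAt_coeff hs hr0
      refine ⟨_, HasDerivWithinAt.fun_sum fun k _ =>
        (hasDerivWithinAt_norm_sq (hd k)).const_mul (tentWeight s N k), ?_⟩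
      refine (le_abs_self _).trans ((abs_sum_energy_le (by linarith)
        (torusFourierCoeff_neg ψ) (h.mem r hr0).summable_sq (hψ.summable_sq (h.mem r hr0))
        (fun k hk => Or.inl (tentWeight_eq_zero (by linarith) hk))
        (abs_tentWeight_sub_le s N)).trans ?_)
      rw [← sobolevNorm_sq s (ω r)]
      have h2 := hD r hr
      have h1 := (hψ.sqrt_tsum_le (h.mem r hr0)).trans
        (mul_le_mul_of_nonneg_left h2 zero_le_two)
      have h3 := sobolevNorm_nonneg s (ω r)
      have hD0 := h3.trans h2
      gcongr
    have hcont : ContinuousOn E (Icc a b) := fun r hr => by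
      obtain ⟨E', h1, -⟩ := hder r hr
      exact h1.continuousWithinAt.mono fun x hx => ha.trans hx.1
    have hda : ∀ r ∈ Ioo a b, ∃ E', HasDerivAt E E' r ∧
        E' ≤ trilinearConst s * (2 * D) * D ^ 2 := fun r hr => by
      obtain ⟨E', h1, h2⟩ := hder r (Ioo_subset_Icc_self hr)
      exact ⟨E', h1.hasDerivAt (Ici_mem_nhds (ha.trans_lt hr.1)), h2⟩
    refine Convex.image_sub_le_mul_sub_of_deriv_le (convex_Icc a b) hcont ?_ ?_ a
      (left_mem_Icc.2 hab) b (right_mem_Icc.2 hab) hab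
    · rw [interior_Icc]
      intro r hr
      obtain ⟨E', h1, -⟩ := hda r hr
      exact h1.differentiableAt.differentiableWithinAt
    · rw [interior_Icc]
      intro r hr
      obtain ⟨E', h1, h2⟩ := hda r hr
      rwa [h1.deriv]
  have hw : ∀ k, bracket k ^ (2 * s) = (bracket k ^ s) ^ 2 := fun k => by
    rw [bracket_rpow_sq, bracket_rpow_two_mul]
  have hya : ∀ N, ∑ k ∈ freqBox (2 * N), tentWeight s N k * ‖torusFourierCoeff (ω a) k‖ ^ 2
      ≤ sobolevNorm s (ω a) ^ 2 := by
    intro N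
    rw [sobolevNorm_sq]
    refine le_trans (Finset.sum_le_sum fun k _ => ?_)
      ((h.mem a ha).summable_sq.sum_le_tsum _ fun k _ => sq_nonneg _)
    rw [mul_pow, ← hw]
    exact mul_le_mul_of_nonneg_right (tentWeight_le s N k) (sq_nonneg _)
  have hyb : sobolevNorm s (ω b) ^ 2
      ≤ sobolevNorm s (ω a) ^ 2 + trilinearConst s * (2 * D) * D ^ 2 * (b - a) := by
    rw [sobolevNorm_sq s (ω b)]
    refine Real.tsum_le_of_sum_le (fun k => sq_nonneg _) fun F => ?_
    obtain ⟨N, hN⟩ : ∃ N : ℕ, ∀ k ∈ F, bracket k ^ (2 * s) ≤ N := by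
      obtain ⟨N, hN⟩ := exists_nat_ge (∑ k ∈ F, bracket k ^ (2 * s))
      exact ⟨N, fun k hk => (Finset.single_le_sum (f := fun k => bracket k ^ (2 * s))
        (fun j _ => Real.rpow_nonneg (bracket_pos j).le _) hk).trans hN⟩
    have h1 : ∑ k ∈ F, (bracket k ^ s * ‖torusFourierCoeff (ω b) k‖) ^ 2
        ≤ ∑ k ∈ freqBox (2 * N), tentWeight s N k * ‖torusFourierCoeff (ω b) k‖ ^ 2 := by
      have h2 : ∀ k ∈ F, (bracket k ^ s * ‖torusFourierCoeff (ω b) k‖) ^ 2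
          = tentWeight s N k * ‖torusFourierCoeff (ω b) k‖ ^ 2 := fun k hk => by
        rw [tentWeight_eq (hN k hk), mul_pow, hw]
      rw [Finset.sum_congr rfl h2]
      refine Finset.sum_le_sum_of_subset_of_nonneg (fun k hk => ?_)
        fun k _ _ => mul_nonneg (tentWeight_nonneg s N k) (sq_nonneg _)
      refine mem_freqBox_of_bracket_le ?_
      have h3 : bracket k ≤ bracket k ^ (2 * s) := by
        simpa using Real.rpow_le_rpow_of_exponent_le (one_le_bracket k)
          (show 1 ≤ 2 * s by linarith)
      push_cast
      linarith [hN k hk, (Nat.cast_nonneg N : (0 : ℝ) ≤ N)]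
    linarith [htent N, hya N]
  linarith

theorem IsEulerSolution.continuousOn_sobolevNorm (h : IsEulerSolution s ω₀ ω) :
    ContinuousOn (fun t => sobolevNorm s (ω t)) (Ici 0) := by
  intro t ht
  rw [ContinuousWithinAt, tendsto_iff_norm_sub_tendsto_zero]
  refine squeeze_zero' (Eventually.of_forall fun r => norm_nonneg _) ?_ (h.continuous t ht)
  filter_upwards [self_mem_nhdsWithin] with r hr
  exact abs_sobolevNorm_sub_le (h.mem r hr) (h.mem t ht)

/-- The a priori estimate for the Euler equation, on the time scale `1/B` on which the norm cannot
double. -/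
theorem IsEulerSolution.sobolevNorm_le (hs : 2 ≤ s) (h : IsEulerSolution s ω₀ ω) {B C T : ℝ}
    (hB : 0 < B) (hC : 0 < C) (hCs : 2 * trilinearConst s ≤ C) (hω₀ : sobolevNorm s ω₀ ≤ B)
    (hT : 4 * C * B * T ≤ Real.log 2) {t : ℝ} (ht : t ∈ Icc 0 T) :
    sobolevNorm s (ω t) ≤ Real.exp (2 * C * B * t) * sobolevNorm s ω₀ := by
  set y : ℝ → ℝ := fun r => sobolevNorm s (ω r) with hy
  have hy0 : ∀ r, 0 ≤ y r := fun r => sobolevNorm_nonneg s (ω r)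
  have hycont : ContinuousOn y (Ici 0) := h.continuousOn_sobolevNorm
  have hinit : y 0 = sobolevNorm s ω₀ := sobolevNorm_congr h.initial s
  have hIcc : Icc 0 T ⊆ Ici (0 : ℝ) := fun r hr => hr.1
  -- comparison with the exponential, for data enlarged by `ε`
  have hcomp : ∀ ε, 0 < ε → ε ≤ B ^ 2 →
      y t ^ 2 ≤ (y 0 ^ 2 + ε) * Real.exp (4 * C * B * t) := by
    intro ε hε hεB
    refine image_le_of_liminf_slope_right_lt_deriv_boundary' (f := fun r => y r ^ 2)
      (f' := fun r => C * y r ^ 3) (a := 0) (b := T)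
      (B := fun r => (y 0 ^ 2 + ε) * Real.exp (4 * C * B * r))
      (B' := fun r => (y 0 ^ 2 + ε) * (Real.exp (4 * C * B * r) * (4 * C * B)))
      ((hycont.mono hIcc).pow 2) ?_ (by simp [hε.le]) (by fun_prop) ?_ ?_ ht
    · intro r hr q hq
      refine Eventually.frequently ?_
      have hc : ContinuousWithinAt (fun z => C * y z ^ 3) (Ici 0) r :=
        ((hycont r hr.1).pow 3).const_mul C
      have hyr : y r < (q / C) ^ ((1 : ℝ) / 3) := by
        have h1 : y r ^ 3 < q / C := by rw [lt_div_iff₀ hC]; linarith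
        have h2 := Real.rpow_lt_rpow (pow_nonneg (hy0 r) 3) h1 (show (0 : ℝ) < 1 / 3 by norm_num)
        rwa [← Real.rpow_natCast, ← Real.rpow_mul (hy0 r), show ((3 : ℕ) : ℝ) * (1 / 3) = 1 by
          norm_num, Real.rpow_one] at h2
      obtain ⟨D, hD1, hD2⟩ := exists_between hyr
      have hD0 : 0 < D := (hy0 r).trans_lt hD1
      have hq0 : 0 ≤ q / C := by
        have : 0 ≤ C * y r ^ 3 := mul_nonneg hC.le (pow_nonneg (hy0 r) 3)
        exact div_nonneg (this.trans hq.le) hC.le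
      have hDq : C * D ^ 3 < q := by
        have h1 := Real.rpow_lt_rpow hD0.le hD2 (show (0 : ℝ) < 3 by norm_num)
        rw [← Real.rpow_mul hq0, show (1 : ℝ) / 3 * 3 = 1 by norm_num, Real.rpow_one,
          lt_div_iff₀ hC] at h1
        have : D ^ (3 : ℝ) = D ^ 3 := by norm_cast
        rw [this] at h1
        linarith
      have hev : ∀ᶠ z in 𝓝[Ici 0] r, y z < D := (hycont r hr.1).eventually_lt_const hD1
      obtain ⟨δ, hδ, hball⟩ := Metric.mem_nhdsWithin_iff.1 hev
      have hev2 : ∀ᶠ z in 𝓝[>] r, z ∈ Ioo r (r + δ) := Ioo_mem_nhdsGT (by linarith)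
      filter_upwards [hev2] with z hz
      have hzr : 0 < z - r := sub_pos.2 hz.1
      have hinc := h.sobolevNorm_sq_sub_le hs (a := r) (b := z) (D := D) hr.1 hz.1.le (by
        intro w hw
        have hw2 : w ∈ Metric.ball r δ ∩ Ici 0 := by
          refine ⟨?_, hr.1.trans hw.1⟩
          rw [Metric.mem_ball, Real.dist_eq, abs_of_nonneg (sub_nonneg.2 hw.1)]
          linarith [hw.2, hz.2]
        exact (hball hw2).le)
      rw [slope_def_field, div_lt_iff₀ hzr]
      calc y z ^ 2 - y r ^ 2 ≤ trilinearConst s * (2 * D) * D ^ 2 * (z - r) := hinc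
        _ = (2 * trilinearConst s) * D ^ 3 * (z - r) := by ring
        _ ≤ C * D ^ 3 * (z - r) := by gcongr
        _ < q * (z - r) := by gcongr
    · intro r _
      have h1 : HasDerivAt (fun r => 4 * C * B * r) (4 * C * B) r := by
        simpa using (hasDerivAt_id r).const_mul (4 * C * B)
      exact (h1.exp.const_mul _).hasDerivWithinAt
    · intro r hr hyr
      set X := (y 0 ^ 2 + ε) * Real.exp (4 * C * B * r) with hX
      have hX0 : 0 < X := by positivity
      have hexp : Real.exp (4 * C * B * r) ≤ 2 := by
        rw [← Real.le_log_iff_exp_le (by norm_num)]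
        refine le_trans ?_ hT
        gcongr
        exact hr.2.le
      have hX4 : X < (4 * B) ^ 2 := by
        have h1 : y 0 ^ 2 ≤ B ^ 2 := by rw [hinit]; gcongr; exact sobolevNorm_nonneg _ _
        calc X ≤ (B ^ 2 + B ^ 2) * 2 := by rw [hX]; gcongr
          _ < (4 * B) ^ 2 := by nlinarith [sq_pos_of_pos hB]
      have hyr4 : y r < 4 * B := by
        refine lt_of_pow_lt_pow_left₀ 2 (by positivity) ?_
        simpa only [hyr] using hX4
      calc C * y r ^ 3 = C * y r * y r ^ 2 := by ring
        _ = C * y r * X := by rw [show y r ^ 2 = X from hyr]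
        _ < C * (4 * B) * X := by gcongr
        _ = (y 0 ^ 2 + ε) * (Real.exp (4 * C * B * r) * (4 * C * B)) := by rw [hX]; ring
  have hlim : y t ^ 2 ≤ y 0 ^ 2 * Real.exp (4 * C * B * t) := by
    have htend : Tendsto (fun ε => (y 0 ^ 2 + ε) * Real.exp (4 * C * B * t)) (𝓝[>] 0)
        (𝓝 ((y 0 ^ 2 + 0) * Real.exp (4 * C * B * t))) := by
      refine Tendsto.mono_left ?_ nhdsWithin_le_nhds
      exact Continuous.tendsto (by fun_prop) 0
    rw [add_zero] at htend
    refine ge_of_tendsto htend ?_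
    filter_upwards [Ioo_mem_nhdsGT (show (0 : ℝ) < B ^ 2 by positivity)] with ε hε
    exact hcomp ε hε.1 hε.2.le
  have hsq : y t ^ 2 ≤ (Real.exp (2 * C * B * t) * y 0) ^ 2 := by
    refine hlim.trans_eq ?_
    rw [mul_pow, ← Real.exp_nat_mul]
    push_cast
    ring_nf
  rw [← hinit]
  exact le_of_sq_le_sq hsq (mul_nonneg (Real.exp_pos _).le (hy0 0))

end Euler

/-! ### Flows of Lipschitz vector fields -/

theorem CellPeriodic.exists_bound {E : Type*} [NormedAddCommGroup E] {F : (Fin 2 → ℝ) → E}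
    (hper : CellPeriodic F) (hF : Continuous F) : ∃ M : NNReal, ∀ x, ‖F x‖ ≤ M := by
  obtain ⟨M, hM⟩ := isCompact_torusCell.exists_bound_of_continuousOn hF.continuousOn
  refine ⟨M.toNNReal, fun x => ?_⟩
  obtain ⟨m, hm⟩ := exists_add_int_mem_torusCell x
  rw [← hper.add_int m x]
  exact (hM _ hm).trans (le_max_left _ _)

section Flow

variable {X : (Fin 2 → ℝ) → (Fin 2 → ℝ)} {Ψ : ℝ → (Fin 2 → ℝ) → (Fin 2 → ℝ)} {K : NNReal}

theorem IsFlowOf.eq_of_hasDerivAt (hX : LipschitzWith K X) (h : IsFlowOf X Ψ) {γ : ℝ → Fin 2 → ℝ}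
    (hγ : ∀ t, HasDerivAt γ (X (γ t)) t) (t : ℝ) : γ t = Ψ t (γ 0) := by
  have := ODE_solution_unique_univ (v := fun _ => X) (s := fun _ => univ) (K := K) (t₀ := 0)
    (fun _ => hX.lipschitzOnWith) (f := γ) (g := fun r => Ψ r (γ 0))
    (fun t => ⟨hγ t, mem_univ _⟩) (fun t => ⟨(h (γ 0)).2 t, mem_univ _⟩) (h (γ 0)).1.symm
  exact congrFun this t

theorem IsFlowOf.add (hX : LipschitzWith K X) (h : IsFlowOf X Ψ) (t r : ℝ) (x : Fin 2 → ℝ) :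
    Ψ (t + r) x = Ψ t (Ψ r x) := by
  have := h.eq_of_hasDerivAt hX (γ := fun t => Ψ (t + r) x)
    (fun t => ((h x).2 (t + r)).comp_add_const t r) t
  simpa using this

theorem IsFlowOf.left_inverse (hX : LipschitzWith K X) (h : IsFlowOf X Ψ) (t : ℝ)
    (x : Fin 2 → ℝ) : Ψ (-t) (Ψ t x) = x := by
  rw [← h.add hX, neg_add_cancel, (h x).1]

theorem IsFlowOf.add_single (hX : LipschitzWith K X) (h : IsFlowOf X Ψ) (hper : CellPeriodic X)
    (t : ℝ) (i : Fin 2) (x : Fin 2 → ℝ) :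
    Ψ t (x + Pi.single i (2 * π)) = Ψ t x + Pi.single i (2 * π) := by
  have := h.eq_of_hasDerivAt hX (γ := fun t => Ψ t x + Pi.single i (2 * π))
    (fun t => by rw [hper]; exact ((h x).2 t).add_const _) t
  simpa [(h x).1] using this.symm

theorem IsFlowOf.neg (h : IsFlowOf X Ψ) : IsFlowOf (-X) fun t => Ψ (-t) := by
  refine fun x => ⟨by simpa using (h x).1, fun t => ?_⟩
  have := HasDerivAt.scomp t ((h x).2 (-t)) (hasDerivAt_neg t)
  rw [neg_one_smul] at this
  exact this

theorem IsFlowOf.lipschitzWith_of_nonneg (hX : LipschitzWith K X) (h : IsFlowOf X Ψ) {t : ℝ}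
    (ht : 0 ≤ t) : LipschitzWith (Real.toNNReal (Real.exp (K * t))) (Ψ t) := by
  refine LipschitzWith.of_dist_le_mul fun x y => ?_
  have hd : ∀ x r, HasDerivAt (fun r => Ψ r x) (X (Ψ r x)) r := fun x r => (h x).2 r
  have := dist_le_of_trajectories_ODE (v := fun _ => X) (f := fun r => Ψ r x)
    (g := fun r => Ψ r y) (a := 0) (b := t) (δ := dist x y) (fun _ => hX)
    (fun r _ => (hd x r).continuousAt.continuousWithinAt) (fun r _ => (hd x r).hasDerivWithinAt)
    (fun r _ => (hd y r).continuousAt.continuousWithinAt) (fun r _ => (hd y r).hasDerivWithinAt)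
    (by rw [(h x).1, (h y).1]) t ⟨ht, le_rfl⟩
  rw [Real.coe_toNNReal _ (Real.exp_pos _).le, mul_comm]
  simpa using this

theorem IsFlowOf.lipschitzWith (hX : LipschitzWith K X) (h : IsFlowOf X Ψ) (t : ℝ) :
    LipschitzWith (Real.toNNReal (Real.exp (K * |t|))) (Ψ t) := by
  rcases le_total 0 t with ht | ht
  · rw [abs_of_nonneg ht]; exact h.lipschitzWith_of_nonneg hX ht
  · rw [abs_of_nonpos ht]
    have hX' : LipschitzWith K (-X) := hX.neg
    simpa using h.neg.lipschitzWith_of_nonneg hX' (neg_nonneg.2 ht)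

theorem IsFlowOf.norm_sub_le (h : IsFlowOf X Ψ) {M : ℝ} (hM : ∀ x, ‖X x‖ ≤ M) (t : ℝ)
    (x : Fin 2 → ℝ) : ‖Ψ t x - x‖ ≤ M * |t| := by
  have := Convex.norm_image_sub_le_of_norm_hasDerivWithin_le (f := fun r => Ψ r x)
    (f' := fun r => X (Ψ r x)) (C := M) (s := univ) (x := 0) (y := t)
    (fun r _ => ((h x).2 r).hasDerivWithinAt) (fun r _ => hM _) convex_univ (mem_univ _)
    (mem_univ _)
  simpa [(h x).1] using this

theorem volume_image_le_of_lipschitzWith {L : NNReal} {Φ : (Fin 2 → ℝ) → (Fin 2 → ℝ)}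
    (hΦ : LipschitzWith L Φ) (A : Set (Fin 2 → ℝ)) :
    volume (Φ '' A) ≤ (L : ENNReal) ^ 2 * volume A := by
  have := hΦ.hausdorffMeasure_image_le (d := 2) (by norm_num) A
  have h2 : (μH[2] : Measure (Fin 2 → ℝ)) = volume := by
    rw [← hausdorffMeasure_pi_real]; simp
  rw [h2] at this
  simpa using this

/-- A flow of a Lipschitz vector field distorts Lebesgue measure by a bounded factor, because the
inverse map is Lipschitz. -/
theorem IsFlowOf.map_volume_le (hX : LipschitzWith K X) (h : IsFlowOf X Ψ) (t : ℝ) :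
    Measure.map (Ψ t) volume
      ≤ ((Real.toNNReal (Real.exp (K * |t|)) ^ 2 : NNReal) : ENNReal) • volume := by
  refine Measure.le_iff.2 fun A hA => ?_
  rw [Measure.map_apply (h.lipschitzWith hX t).continuous.measurable hA]
  have hpre : Ψ t ⁻¹' A ⊆ Ψ (-t) '' A := fun x hx => ⟨Ψ t x, hx, h.left_inverse hX t x⟩
  refine (measure_mono hpre).trans ?_
  have := volume_image_le_of_lipschitzWith (h.lipschitzWith hX (-t)) A
  rw [abs_neg] at this
  simpa using this

theorem IsFlowOf.ae_comp (hX : LipschitzWith K X) (h : IsFlowOf X Ψ) (t : ℝ)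
    {p : (Fin 2 → ℝ) → Prop} (hp : ∀ᵐ x, p x) : ∀ᵐ x, p (Ψ t x) := by
  have hac : Measure.map (Ψ t) volume ≪ volume :=
    (Measure.absolutelyContinuous_of_le (h.map_volume_le hX t)).trans
      (Measure.AbsolutelyContinuous.rfl.smul_left _)
  exact ae_of_ae_map (h.lipschitzWith hX t).continuous.aemeasurable (hac.ae_le hp)

/-- A bounded set is covered by finitely many translates of the cell, so the integral of a periodic
function over it is controlled by the integral over the cell. -/
theorem setLIntegral_le_card_mul {g : (Fin 2 → ℝ) → ENNReal} (hper : CellPeriodic g)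
    {D : Set (Fin 2 → ℝ)} {N : ℕ} (hD : ∀ x ∈ D, ‖x‖ ≤ N) :
    ∫⁻ x in D, g x ≤ (freqBox (N + 1)).card * ∫⁻ x in torusCell, g x := by
  have hsub : D ⊆ ⋃ m ∈ freqBox (N + 1),
      (fun x : Fin 2 → ℝ => x + fun i => (m i : ℝ) * (2 * π)) ⁻¹' torusCell := by
    intro x hx
    obtain ⟨m, hm⟩ := exists_add_int_mem_torusCell x
    refine mem_biUnion (x := m) (mem_freqBox.2 fun i => ?_) hm
    have h1 := hm.1 i
    have h2 := hm.2 i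
    have h3 := abs_le.1 ((norm_le_pi_norm x i).trans (hD x hx))
    simp only [Pi.zero_apply, Pi.add_apply] at h1 h2
    have hpi : 1 < 2 * π := by linarith [pi_gt_three]
    have hN : (0 : ℝ) ≤ N := Nat.cast_nonneg N
    have h4 : |(m i : ℝ)| ≤ N + 1 := by
      rw [abs_le]
      constructor <;> nlinarith
    exact_mod_cast h4
  have hle : volume.restrict (⋃ m ∈ freqBox (N + 1),
      (fun x : Fin 2 → ℝ => x + fun i => (m i : ℝ) * (2 * π)) ⁻¹' torusCell)
      ≤ ∑ m ∈ freqBox (N + 1), volume.restrict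
        ((fun x : Fin 2 → ℝ => x + fun i => (m i : ℝ) * (2 * π)) ⁻¹' torusCell) := by
    refine Measure.le_iff.2 fun A hA => ?_
    rw [Measure.restrict_apply hA, Measure.finsetSum_apply, inter_iUnion₂]
    refine (measure_biUnion_finset_le _ _).trans_eq (Finset.sum_congr rfl fun m _ => ?_)
    rw [Measure.restrict_apply hA]
  refine (lintegral_mono_set hsub).trans ((lintegral_mono' hle le_rfl).trans ?_)
  rw [lintegral_finsetSum_measure]
  have : ∀ m : Fin 2 → ℤ,
      ∫⁻ x in (fun x : Fin 2 → ℝ => x + fun i => (m i : ℝ) * (2 * π)) ⁻¹' torusCell, g x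
        = ∫⁻ x in torusCell, g x := by
    intro m
    have := (measurePreserving_add_right volume
      (fun i => (m i : ℝ) * (2 * π))).setLIntegral_comp_preimage_emb
      (measurableEmbedding_addRight _) g torusCell
    simpa only [hper.add_int] using this
  simp [this]

/-- Composition with the flow is bounded on the integrals over the cell, uniformly for times in a
bounded interval. -/
theorem IsFlowOf.exists_lintegral_comp_le (hX : LipschitzWith K X) (h : IsFlowOf X Ψ) {M : NNReal}
    (hM : ∀ x, ‖X x‖ ≤ M) (T : NNReal) :
    ∃ C : NNReal, ∀ t : ℝ, |t| ≤ T → ∀ g : (Fin 2 → ℝ) → ENNReal, Measurable g → CellPeriodic g →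
      ∫⁻ x in torusCell, g (Ψ t x) ≤ C * ∫⁻ x in torusCell, g x := by
  obtain ⟨N, hN⟩ := exists_nat_ge (2 * π + M * T)
  refine ⟨Real.toNNReal (Real.exp (K * T)) ^ 2 * (freqBox (N + 1)).card, fun t ht g hg hper => ?_⟩
  have hcont := (h.lipschitzWith hX t).continuous
  set D := Ψ t '' torusCell with hD
  have hDm : MeasurableSet D := (isCompact_torusCell.image hcont).measurableSet
  have hDN : ∀ x ∈ D, ‖x‖ ≤ N := by
    rintro _ ⟨x, hx, rfl⟩
    have h1 := h.norm_sub_le hM t x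
    have h2 : ‖x‖ ≤ 2 * π := by
      refine (pi_norm_le_iff_of_nonneg (by positivity)).2 fun i => ?_
      rw [Real.norm_of_nonneg (hx.1 i)]
      exact hx.2 i
    calc ‖Ψ t x‖ ≤ ‖x‖ + ‖Ψ t x - x‖ := by simpa using norm_add_le x (Ψ t x - x)
      _ ≤ 2 * π + M * T := by
          refine add_le_add h2 (h1.trans ?_)
          gcongr
      _ ≤ N := hN
  calc ∫⁻ x in torusCell, g (Ψ t x) ≤ ∫⁻ x in Ψ t ⁻¹' D, g (Ψ t x) :=
        lintegral_mono_set (subset_preimage_image _ _)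
    _ = ∫⁻ x in D, g x ∂(Measure.map (Ψ t) volume) := by
        rw [Measure.restrict_map hcont.measurable hDm, lintegral_map hg hcont.measurable]
    _ ≤ ∫⁻ x in D, g x
          ∂(((Real.toNNReal (Real.exp (K * |t|)) ^ 2 : NNReal) : ENNReal) • volume) :=
        lintegral_mono' (Measure.restrict_mono_measure (h.map_volume_le hX t) D) le_rfl
    _ = ((Real.toNNReal (Real.exp (K * |t|)) ^ 2 : NNReal) : ENNReal) * ∫⁻ x in D, g x := by
        rw [Measure.restrict_smul, lintegral_smul_measure, smul_eq_mul]
    _ ≤ ((Real.toNNReal (Real.exp (K * T)) ^ 2 : NNReal) : ENNReal)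
          * ((freqBox (N + 1)).card * ∫⁻ x in torusCell, g x) := by
        gcongr
        exact setLIntegral_le_card_mul hper hDN
    _ = _ := by push_cast; rw [mul_assoc]

end Flow

section VelocityField

variable {ω ψ : (Fin 2 → ℝ) → ℝ}

theorem IsInvLaplacian.contDiff_symplecticGrad (h : IsInvLaplacian ω ψ) :
    ContDiff ℝ 1 (symplecticGrad ψ) := by
  rw [contDiff_pi]
  intro i
  fin_cases i
  · exact contDiff_partialD h.contDiff (by norm_num) 1
  · exact (contDiff_partialD h.contDiff (by norm_num) 0).neg

theorem IsInvLaplacian.cellPeriodic_symplecticGrad (h : IsInvLaplacian ω ψ) :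
    CellPeriodic (symplecticGrad ψ) := fun i x => by
  simp only [symplecticGrad, h.periodic.partialD _ i x]

theorem IsInvLaplacian.exists_lipschitzWith (h : IsInvLaplacian ω ψ) :
    ∃ K, LipschitzWith K (symplecticGrad ψ) := by
  have hc := h.contDiff_symplecticGrad
  have hper : CellPeriodic (fderiv ℝ (symplecticGrad ψ)) := by
    intro i x
    rw [← fderiv_comp_add_right]
    congr 1
    exact funext fun y => h.cellPeriodic_symplecticGrad i y
  obtain ⟨K, hK⟩ := hper.exists_bound (hc.continuous_fderiv (by simp))
  exact ⟨K, lipschitzWith_of_nnnorm_fderiv_le (hc.differentiable (by simp)) fun x => hK x⟩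

end VelocityField

/-! ### Galerkin approximation of the transport equation -/

section Galerkin

variable {s : ℝ} {p : (Fin 2 → ℤ) → ℂ} {S : Finset (Fin 2 → ℤ)}

theorem transportCoeff_eq_sum {a : (Fin 2 → ℤ) → ℂ} (ha : ∀ l ∉ S, a l = 0) (k : Fin 2 → ℤ) :
    transportCoeff p a k = ∑ l ∈ S, (cross k l : ℂ) * p (k - l) * a l :=
  tsum_eq_sum fun l hl => by rw [ha l hl, mul_zero]

/-- The Galerkin truncation of the transport equation to the frequencies in `S` is a linear system
of ordinary differential equations, so it has a global solution. -/
theorem exists_galerkin (p : (Fin 2 → ℤ) → ℂ) (S : Finset (Fin 2 → ℤ)) (a₀ : (Fin 2 → ℤ) → ℂ) :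
    ∃ a : ℝ → (Fin 2 → ℤ) → ℂ, (∀ t, ∀ k ∉ S, a t k = 0) ∧ (∀ k ∈ S, a 0 k = a₀ k) ∧
      ∀ t, ∀ k ∈ S, HasDerivAt (fun r => a r k) (transportCoeff p (a t) k) t := by
  classical
  let A : (S → ℂ) →L[ℝ] (S → ℂ) := (LinearMap.toContinuousLinearMap
    (Matrix.toLin' (Matrix.of fun k l : S => (cross k l : ℂ) * p (k - l)))).restrictScalars ℝ
  let v : ℝ → S → ℂ := fun t => NormedSpace.exp (t • A) fun k => a₀ k
  have hv : ∀ t, HasDerivAt v (A (v t)) t := fun t =>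
    (hasDerivAt_exp_smul_const' A t).clm_apply (hasDerivAt_const t _) |>.congr_deriv (by simp [v])
  have hv0 : v 0 = fun k : S => a₀ k := by
    have h0 : (0 : ℝ) • A = 0 := by ext; simp
    have h1 : v 0 = NormedSpace.exp ((0 : ℝ) • A) fun k => a₀ k := rfl
    rw [h1, h0, NormedSpace.exp_zero]
    rfl
  refine ⟨fun t k => if h : k ∈ S then v t ⟨k, h⟩ else 0, fun t k hk => by simp [hk],
    fun k hk => by simp only [hk, dite_true, hv0], fun t k hk => ?_⟩
  have hsum := transportCoeff_eq_sum (p := p) (S := S)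
    (a := fun k => if h : k ∈ S then v t ⟨k, h⟩ else 0) (fun l hl => by simp [hl]) k
  rw [hsum, ← Finset.sum_coe_sort]
  have h1 := (hasDerivAt_pi.1 (hv t)) ⟨k, hk⟩
  simp only [hk, dite_true]
  refine h1.congr_deriv ?_
  simp [A, Matrix.mulVec, dotProduct]

/-- The `H^s` energy of the Galerkin approximation grows at a rate that does not depend on the
truncation. -/
theorem galerkin_energy_le (hs : 1 < s) (hconj : ∀ j, p (-j) = (starRingEnd ℂ) (p j))
    (hps : Summable fun k => (bracket k ^ (s + 2) * ‖p k‖) ^ 2) {a : ℝ → (Fin 2 → ℤ) → ℂ}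
    (hsupp : ∀ t, ∀ k ∉ S, a t k = 0)
    (hder : ∀ t, ∀ k ∈ S, HasDerivAt (fun r => a r k) (transportCoeff p (a t) k) t)
    {t : ℝ} (ht : 0 ≤ t) :
    ∑ k ∈ S, (bracket k ^ s * ‖a t k‖) ^ 2
      ≤ (∑ k ∈ S, (bracket k ^ s * ‖a 0 k‖) ^ 2) * Real.exp (trilinearConst s
        * √(∑' k, (bracket k ^ (s + 2) * ‖p k‖) ^ 2) * t) := by
  have hzero : ∀ r, ∀ k ∉ S, (bracket k ^ s * ‖a r k‖) ^ 2 = 0 := fun r k hk => by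
    simp [hsupp r k hk]
  set E : ℝ → ℝ := fun r => ∑ k ∈ S, (bracket k ^ s * ‖a r k‖) ^ 2 with hE
  have hE0 : ∀ r, 0 ≤ E r := fun r => Finset.sum_nonneg fun k _ => sq_nonneg _
  have hd : ∀ r, HasDerivAt E (∑ k ∈ S, bracket k ^ (2 * s)
      * (2 * ((starRingEnd ℂ) (a r k) * transportCoeff p (a r) k).re)) r := by
    intro r
    refine HasDerivAt.fun_sum fun k hk => ?_
    have h1 : HasDerivAt (fun q => ‖a q k‖ ^ 2)
        (2 * ((starRingEnd ℂ) (a r k) * transportCoeff p (a r) k).re) r := by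
      rw [← hasDerivWithinAt_univ]
      exact hasDerivWithinAt_norm_sq (hder r k hk).hasDerivWithinAt
    have h2 := h1.const_mul (bracket k ^ (2 * s))
    simp only [mul_pow]
    rwa [show (bracket k ^ s) ^ 2 = bracket k ^ (2 * s) by
      rw [bracket_rpow_sq, bracket_rpow_two_mul]]
  have h := norm_le_gronwallBound_of_norm_deriv_right_le (f := E) (a := 0) (b := t) (δ := E 0)
    (K := trilinearConst s * √(∑' k, (bracket k ^ (s + 2) * ‖p k‖) ^ 2)) (ε := 0)
    (fun r _ => (hd r).continuousAt.continuousWithinAt) (fun r _ => (hd r).hasDerivWithinAt)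
    (by rw [Real.norm_of_nonneg (hE0 0)]) (fun r _ => by
      rw [add_zero, Real.norm_of_nonneg (hE0 r), Real.norm_eq_abs]
      have := abs_sum_energy_le hs hconj (summable_of_ne_finset_zero (hzero r)) hps
        (m := fun k => bracket k ^ (2 * s)) (fun k hk => Or.inr (hsupp r k hk)) fun k l => le_rfl
      rwa [tsum_eq_sum (hzero r)] at this) t ⟨ht, le_rfl⟩
  rw [gronwallBound_ε0, Real.norm_of_nonneg (hE0 t), sub_zero] at h
  exact h

theorem summable_norm_transportCoeff
    (hp : Summable fun k => bracket k ^ 2 * ‖p k‖) {a : (Fin 2 → ℤ) → ℂ} (ha : ∀ l ∉ S, a l = 0) :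
    Summable (fun k => ‖transportCoeff p a k‖) ∧
      ∑' k, ‖transportCoeff p a k‖
        ≤ (∑ l ∈ S, bracket l * ‖a l‖) * ∑' k, bracket k ^ 2 * ‖p k‖ := by
  have hle : ∀ k, ‖transportCoeff p a k‖
      ≤ ∑ l ∈ S, bracket l * ‖a l‖ * (bracket (k - l) ^ 2 * ‖p (k - l)‖) := by
    intro k
    rw [transportCoeff_eq_sum ha]
    refine norm_sum_le_of_le _ fun l _ => ?_
    simp only [norm_mul, Complex.norm_real, Real.norm_eq_abs]
    have hj := one_le_bracket (k - l)
    have hl := bracket_pos l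
    calc |cross k l| * ‖p (k - l)‖ * ‖a l‖
        ≤ (bracket (k - l) ^ 2 * bracket l) * ‖p (k - l)‖ * ‖a l‖ := by
          gcongr
          refine (abs_cross_le_sub_right k l).trans (mul_le_mul_of_nonneg_right ?_ hl.le)
          nlinarith
      _ = _ := by ring
  have hsh : ∀ l, Summable fun k => bracket (k - l) ^ 2 * ‖p (k - l)‖ := fun l =>
    (Equiv.subRight l).summable_iff.2 hp
  have hshe : ∀ l, ∑' k, bracket (k - l) ^ 2 * ‖p (k - l)‖ = ∑' k, bracket k ^ 2 * ‖p k‖ :=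
    fun l => (Equiv.subRight l).tsum_eq fun k => bracket k ^ 2 * ‖p k‖
  have hsum : Summable fun k => ∑ l ∈ S, bracket l * ‖a l‖ * (bracket (k - l) ^ 2 * ‖p (k - l)‖) :=
    summable_sum fun l _ => (hsh l).mul_left _
  have hs1 := Summable.of_nonneg_of_le (fun k => norm_nonneg _) hle hsum
  refine ⟨hs1, (hs1.tsum_le_tsum hle hsum).trans_eq ?_⟩
  rw [Summable.tsum_finsetSum fun l _ => (hsh l).mul_left _, Finset.sum_mul]
  exact Finset.sum_congr rfl fun l _ => by rw [tsum_mul_left, hshe]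

end Galerkin

section TransportOfPolynomials

variable {s : ℝ} {ω ψ : (Fin 2 → ℝ) → ℝ} {S : Finset (Fin 2 → ℤ)}

/-- The transport term of a trigonometric polynomial along `J∇ψ`, as an absolutely convergent
trigonometric series. -/
theorem sum_mul_fderiv_torusExp (hs : 1 < s) (h : IsInvLaplacian ω ψ) (hω : MemSobolev s ω)
    {a : (Fin 2 → ℤ) → ℂ} (ha : ∀ l ∉ S, a l = 0) (y : Fin 2 → ℝ) :
    ∑ l ∈ S, a l * fderiv ℝ (torusExp l) y (symplecticGrad ψ y)
      = ∑' k, transportCoeff (torusFourierCoeff ψ) a k * torusExp k y := by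
  set p := torusFourierCoeff ψ with hp
  have hψ1 : ContDiff ℝ 1 ψ := h.contDiff.of_le (by norm_num)
  have hvel : ∀ i, HasSum (fun j => (Complex.I * j i * p j) * torusExp j y) (partialD i ψ y : ℂ) := by
    intro i
    rw [h.partialD_eq_trigSeries hs hω i y]
    have h1 := (summable_mul_torusExp (h.summable_partialD hs hω i) y).hasSum
    simpa only [torusFourierCoeff_partialD hψ1 h.periodic] using h1
  have hl : ∀ l, HasSum (fun k => (cross k l : ℂ) * p (k - l) * torusExp k y)
      (fderiv ℝ (torusExp l) y (symplecticGrad ψ y)) := by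
    intro l
    have h1 := (((hvel 1).mul_left (l 0 : ℂ)).sub ((hvel 0).mul_left (l 1 : ℂ))).mul_left
      (Complex.I * torusExp l y)
    rw [← (Equiv.subRight l).hasSum_iff] at h1
    convert! h1 using 1
    · ext k
      have he : torusExp k y = torusExp (k - l) y * torusExp l y := by
        rw [← torusExp_add, sub_add_cancel]
      simp only [Function.comp_apply, Equiv.subRight_apply, he, cross, Pi.sub_apply]
      push_cast
      linear_combination (((k 0 : ℂ) * l 1 - k 1 * l 0) * p (k - l) * torusExp (k - l) y
        * torusExp l y) * Complex.I_sq
    · rw [fderiv_torusExp_apply]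
      simp [Fin.sum_univ_two, symplecticGrad]
      ring
  have hsum : HasSum (fun k => ∑ l ∈ S, a l * ((cross k l : ℂ) * p (k - l) * torusExp k y))
      (∑ l ∈ S, a l * fderiv ℝ (torusExp l) y (symplecticGrad ψ y)) :=
    hasSum_sum fun l _ => (hl l).mul_left (a l)
  rw [← hsum.tsum_eq]
  refine tsum_congr fun k => ?_
  rw [transportCoeff_eq_sum ha, Finset.sum_mul]
  exact Finset.sum_congr rfl fun l _ => by ring

theorem tsum_sub_sum_eq_tail {c : (Fin 2 → ℤ) → ℂ} (hc : Summable fun k => ‖c k‖)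
    (S : Finset (Fin 2 → ℤ)) (y : Fin 2 → ℝ) :
    ∑' k, c k * torusExp k y - ∑ k ∈ S, c k * torusExp k y
      = ∑' k, (if k ∈ S then 0 else c k) * torusExp k y := by
  have h1 : ∑ k ∈ S, c k * torusExp k y = ∑' k, (if k ∈ S then c k else 0) * torusExp k y := by
    rw [tsum_eq_sum (s := S) fun k hk => by simp [hk]]
    exact Finset.sum_congr rfl fun k hk => by simp [hk]
  have h2 : Summable fun k => (if k ∈ S then c k else 0) * torusExp k y :=
    summable_of_ne_finset_zero (s := S) fun k hk => by simp [hk]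
  rw [h1, ← (summable_mul_torusExp hc y).tsum_sub h2]
  refine tsum_congr fun k => ?_
  split_ifs <;> ring

theorem norm_tail_le (S : Finset (Fin 2 → ℤ)) (c : (Fin 2 → ℤ) → ℂ) (k : Fin 2 → ℤ) :
    ‖if k ∈ S then 0 else c k‖ ≤ ‖c k‖ := by
  split_ifs <;> simp

theorem summable_norm_tail {c : (Fin 2 → ℤ) → ℂ} (hc : Summable fun k => ‖c k‖)
    (S : Finset (Fin 2 → ℤ)) : Summable fun k => ‖if k ∈ S then 0 else c k‖ := by
  exact Summable.of_nonneg_of_le (fun k => norm_nonneg _) (norm_tail_le S c) hc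

/-- The `L¹` norm of the high-frequency part of a function in `H^1` decays. -/
theorem integral_norm_tail_le {c : (Fin 2 → ℤ) → ℂ} (hc : Summable fun k => ‖c k‖)
    (hc2 : Summable fun k => (bracket k * ‖c k‖) ^ 2) {Q : ℝ}
    (hQ : ∑' k, (bracket k * ‖c k‖) ^ 2 ≤ Q) {N : ℕ} (hN : 0 < N) :
    ∫ y in torusCell, ‖∑' k, (if k ∈ freqBox N then 0 else c k) * torusExp k y‖
      ≤ (2 * π) ^ 2 * (1 + Q) / N := by
  set d : (Fin 2 → ℤ) → ℂ := fun k => if k ∈ freqBox N then 0 else c k with hd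
  have hds : Summable fun k => ‖d k‖ := summable_norm_tail hc _
  have hcont := continuous_trigSeries hds
  have hN' : (0 : ℝ) < N := by exact_mod_cast hN
  have hpars := (hasSum_sq_fourierCoeffC (memLp_cell_of_continuous hcont 2)).tsum_eq
  simp only [fourierCoeffC_trigSeries hds] at hpars
  have hdk : ∀ k, ‖d k‖ ^ 2 ≤ ((N : ℝ) ^ 2)⁻¹ * (bracket k * ‖c k‖) ^ 2 := by
    intro k
    by_cases hk : k ∈ freqBox N
    · simp only [hd, hk, if_true, norm_zero, zero_pow two_ne_zero]
      positivity
    · have h1 := (lt_bracket_of_notMem_freqBox hk).le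
      simp only [hd, hk, if_false]
      rw [mul_pow, inv_mul_eq_div, le_div_iff₀ (by positivity), mul_comm]
      gcongr
  have hsq : ∑' k, ‖d k‖ ^ 2 ≤ ((N : ℝ) ^ 2)⁻¹ * Q := by
    have hs := hc2.mul_left ((N : ℝ) ^ 2)⁻¹
    refine ((Summable.of_nonneg_of_le (fun k => sq_nonneg _) hdk hs).tsum_le_tsum hdk hs).trans ?_
    rw [tsum_mul_left]
    gcongr
  rw [hpars, inv_mul_le_iff₀ (by positivity)] at hsq
  -- the arithmetic-geometric mean inequality with parameter `N`
  have hamgm : ∀ y, ‖∑' k, d k * torusExp k y‖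
      ≤ (N : ℝ)⁻¹ + N * ‖∑' k, d k * torusExp k y‖ ^ 2 := by
    intro y
    set z := ‖∑' k, d k * torusExp k y‖
    have hz : 0 ≤ z := norm_nonneg _
    have h1 : z * N ≤ 1 + (z * N) ^ 2 := by nlinarith [sq_nonneg (z * N - 1)]
    have h2 : (N : ℝ)⁻¹ + N * z ^ 2 = (1 + (z * N) ^ 2) / N := by field_simp
    rw [h2, le_div_iff₀ hN']
    exact h1
  have hi1 : IntegrableOn (fun y => N * ‖∑' k, d k * torusExp k y‖ ^ 2) torusCell :=
    integrableOn_cell_of_continuous (continuous_const.mul (hcont.norm.pow 2))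
  have hi0 : IntegrableOn (fun _ : Fin 2 → ℝ => (N : ℝ)⁻¹) torusCell :=
    integrableOn_cell_of_continuous continuous_const
  calc _ ≤ ∫ y in torusCell, ((N : ℝ)⁻¹ + N * ‖∑' k, d k * torusExp k y‖ ^ 2) := by
        refine integral_mono (integrableOn_cell_of_continuous hcont.norm) ?_ hamgm
        exact hi0.add hi1
    _ = (2 * π) ^ 2 * (N : ℝ)⁻¹ + N * ∫ y in torusCell, ‖∑' k, d k * torusExp k y‖ ^ 2 := by
        rw [integral_add hi0 hi1, integral_const_mul]
        simp [volume_real_torusCell]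
    _ ≤ (2 * π) ^ 2 * (N : ℝ)⁻¹ + N * ((2 * π) ^ 2 * (((N : ℝ) ^ 2)⁻¹ * Q)) := by gcongr
    _ = _ := by field_simp

end TransportOfPolynomials

/-! ### The frozen equation -/

theorem norm_fourierCoeffC_le {F : (Fin 2 → ℝ) → ℂ} {D : ℝ}
    (hD : ∫ x in torusCell, ‖F x‖ ≤ D) (k : Fin 2 → ℤ) :
    ‖fourierCoeffC F k‖ ≤ ((2 * π) ^ 2)⁻¹ * D := by
  rw [fourierCoeffC, norm_smul, Real.norm_of_nonneg (by positivity)]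
  refine mul_le_mul_of_nonneg_left ((norm_integral_le_integral_norm _).trans ?_) (by positivity)
  simpa using hD

theorem tendsto_freqBox : Tendsto freqBox atTop atTop := by
  refine tendsto_atTop_finset_of_monotone (fun m n hmn k hk => ?_) fun k => ?_
  · rw [mem_freqBox] at hk ⊢
    exact fun i => (hk i).trans (by exact_mod_cast hmn)
  · obtain ⟨N, hN⟩ := exists_nat_ge (bracket k)
    exact ⟨N, mem_freqBox_of_bracket_le hN⟩

theorem tendsto_tail {c : (Fin 2 → ℤ) → ℂ} (hc : Summable fun k => ‖c k‖) :
    Tendsto (fun N => ∑' k, ‖if k ∈ freqBox N then 0 else c k‖) atTop (𝓝 0) := by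
  have h1 : Tendsto (fun N => ∑' k, ‖c k‖ - ∑ k ∈ freqBox N, ‖c k‖) atTop (𝓝 0) := by
    have := (hc.hasSum.comp tendsto_freqBox).const_sub (∑' k, ‖c k‖)
    simpa using this
  refine h1.congr fun N => ?_
  have h2 : ∑ k ∈ freqBox N, ‖c k‖ = ∑' k, if k ∈ freqBox N then ‖c k‖ else 0 := by
    rw [tsum_eq_sum (s := freqBox N) fun k hk => by simp [hk]]
    exact Finset.sum_congr rfl fun k hk => by simp [hk]
  have h3 : Summable fun k => if k ∈ freqBox N then ‖c k‖ else 0 :=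
    summable_of_ne_finset_zero (s := freqBox N) fun k hk => by simp [hk]
  rw [h2, ← hc.tsum_sub h3]
  refine tsum_congr fun k => ?_
  split_ifs <;> simp

section AlongTheFlow

variable {s : ℝ} {ω ψ : (Fin 2 → ℝ) → ℝ} {Ψ : ℝ → (Fin 2 → ℝ) → (Fin 2 → ℝ)}
  {S : Finset (Fin 2 → ℤ)} {a : ℝ → (Fin 2 → ℤ) → ℂ}

/-- Along the backward trajectories, the Galerkin approximation changes at the rate given by the
transport term that the truncation has dropped. -/
theorem hasDerivAt_galerkin_flow (hs : 1 < s) (h : IsInvLaplacian ω ψ) (hω : MemSobolev s ω)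
    (hΨ : IsFlowOf (symplecticGrad ψ) Ψ) (hsupp : ∀ t, ∀ k ∉ S, a t k = 0)
    (hder : ∀ t, ∀ k ∈ S,
      HasDerivAt (fun r => a r k) (transportCoeff (torusFourierCoeff ψ) (a t) k) t)
    (t r : ℝ) (x : Fin 2 → ℝ) :
    HasDerivAt (fun q => ∑ k ∈ S, a q k * torusExp k (Ψ (t - q) x))
      (-∑' k, (if k ∈ S then 0 else transportCoeff (torusFourierCoeff ψ) (a r) k)
        * torusExp k (Ψ (t - r) x)) r := by
  have hflow : HasDerivAt (fun q => Ψ (t - q) x) (-symplecticGrad ψ (Ψ (t - r) x)) r := by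
    have := HasDerivAt.scomp r ((hΨ x).2 (t - r)) ((hasDerivAt_id r).const_sub t)
    rw [neg_one_smul] at this
    exact this
  have hexp : ∀ k, HasDerivAt (fun q => torusExp k (Ψ (t - q) x))
      (-fderiv ℝ (torusExp k) (Ψ (t - r) x) (symplecticGrad ψ (Ψ (t - r) x))) r := by
    intro k
    have := (hasFDerivAt_torusExp k (Ψ (t - r) x)).differentiableAt.hasFDerivAt.comp_hasDerivAt r
      hflow
    rwa [map_neg] at this
  have hsum := HasDerivAt.fun_sum fun k (hk : k ∈ S) => (hder r k hk).mul (hexp k)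
  refine hsum.congr_deriv ?_
  have hc := (summable_norm_transportCoeff
    (summable_bracket_sq_mul_norm hs (h.summable_sq hω)).1 (hsupp r)).1
  rw [← tsum_sub_sum_eq_tail hc, ← sum_mul_fderiv_torusExp hs h hω (hsupp r), neg_sub,
    ← Finset.sum_sub_distrib]
  exact Finset.sum_congr rfl fun k _ => by ring

/-- The Fourier coefficients of the Galerkin approximation at time `t` are close to those of its
initial value composed with the flow, when the dropped transport terms are small in `L¹`. -/
theorem norm_galerkin_sub_le (hs : 1 < s) (h : IsInvLaplacian ω ψ) (hω : MemSobolev s ω)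
    (hΨ : IsFlowOf (symplecticGrad ψ) Ψ) (hΨc : ∀ t, Continuous (Ψ t))
    (hsupp : ∀ t, ∀ k ∉ S, a t k = 0)
    (hder : ∀ t, ∀ k ∈ S,
      HasDerivAt (fun r => a r k) (transportCoeff (torusFourierCoeff ψ) (a t) k) t)
    {t D : ℝ} (ht : 0 ≤ t)
    (hD : ∀ r ∈ Icc 0 t, ∫ x in torusCell,
      ‖∑' k, (if k ∈ S then 0 else transportCoeff (torusFourierCoeff ψ) (a r) k)
        * torusExp k (Ψ (t - r) x)‖ ≤ D) (k : Fin 2 → ℤ) :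
    ‖a t k - fourierCoeffC (fun x => ∑ l ∈ S, a 0 l * torusExp l (Ψ t x)) k‖
      ≤ ((2 * π) ^ 2)⁻¹ * D * t := by
  set c : ℝ → (Fin 2 → ℤ) → ℂ := fun r => transportCoeff (torusFourierCoeff ψ) (a r) with hc
  have hf := (summable_bracket_sq_mul_norm hs (h.summable_sq hω)).1
  have hcs : ∀ r, Summable fun k => ‖c r k‖ := fun r =>
    (summable_norm_transportCoeff hf (hsupp r)).1
  set R : ℝ → (Fin 2 → ℝ) → ℂ := fun r y => ∑' k, (if k ∈ S then 0 else c r k) * torusExp k y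
  have hRcont : ∀ r, Continuous (R r) := fun r =>
    continuous_trigSeries (summable_norm_tail (hcs r) S)
  set F : ℝ → (Fin 2 → ℝ) → ℂ := fun r x => (∑ l ∈ S, a r l * torusExp l (Ψ (t - r) x))
    * torusExp (-k) x with hF
  have hFcont : ∀ r, Continuous (F r) := fun r =>
    (continuous_finsetSum _ fun l _ => continuous_const.mul
      ((continuous_torusExp l).comp (hΨc _))).mul (continuous_torusExp _)
  have hF'cont : ∀ r, Continuous fun x => -R r (Ψ (t - r) x) * torusExp (-k) x := fun r =>
    ((hRcont r).comp (hΨc _)).neg.mul (continuous_torusExp _)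
  -- a bound on the derivative that is uniform for times in a neighbourhood
  have hacont : Continuous fun r => ∑ l ∈ S, bracket l * ‖a r l‖ :=
    continuous_finsetSum _ fun l hl => continuous_const.mul
      (continuous_iff_continuousAt.2 fun r => (hder r l hl).continuousAt).norm
  have hRbound : ∀ r y, ‖R r y‖ ≤ (∑ l ∈ S, bracket l * ‖a r l‖)
      * ∑' k, bracket k ^ 2 * ‖torusFourierCoeff ψ k‖ := by
    intro r y
    refine (norm_trigSeries_le (summable_norm_tail (hcs r) S) y).trans
      (le_trans ?_ (summable_norm_transportCoeff hf (hsupp r)).2)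
    exact (summable_norm_tail (hcs r) S).tsum_le_tsum (norm_tail_le S _) (hcs r)
  have hHder : ∀ r, HasDerivAt (fun r => ∫ x in torusCell, F r x)
      (∫ x in torusCell, -R r (Ψ (t - r) x) * torusExp (-k) x) r := by
    intro r
    obtain ⟨M, hM⟩ := (isCompact_closedBall r 1).exists_bound_of_continuousOn hacont.continuousOn
    have hP0 : 0 ≤ ∑' k, bracket k ^ 2 * ‖torusFourierCoeff ψ k‖ :=
      tsum_nonneg fun k => by positivity
    refine (hasDerivAt_integral_of_dominated_loc_of_deriv_le
      (F := F) (F' := fun r x => -R r (Ψ (t - r) x) * torusExp (-k) x)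
      (bound := fun _ => M * ∑' k, bracket k ^ 2 * ‖torusFourierCoeff ψ k‖)
      (Metric.ball_mem_nhds r one_pos)
      (Eventually.of_forall fun q => (hFcont q).aestronglyMeasurable)
      (integrableOn_cell_of_continuous (hFcont r)) (hF'cont r).aestronglyMeasurable
      (Eventually.of_forall fun x q hq => ?_)
      (integrableOn_cell_of_continuous continuous_const)
      (Eventually.of_forall fun x q _ => ?_)).2
    · rw [norm_mul, norm_neg, norm_torusExp, mul_one]
      refine (hRbound q _).trans (mul_le_mul_of_nonneg_right ?_ hP0)
      exact (le_abs_self _).trans (hM q (Metric.ball_subset_closedBall hq))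
    · exact (hasDerivAt_galerkin_flow hs h hω hΨ hsupp hder t q x).mul_const _
  have hmvt := norm_image_sub_le_of_norm_deriv_le_segment' (f := fun r => ∫ x in torusCell, F r x)
    (a := 0) (b := t) (C := D) (fun r _ => (hHder r).hasDerivWithinAt) (fun r hr => by
      refine (norm_integral_le_integral_norm _).trans ?_
      simp only [norm_mul, norm_neg, norm_torusExp, mul_one]
      exact hD r ⟨hr.1, hr.2.le⟩) t ⟨ht, le_rfl⟩
  have hat : a t k = fourierCoeffC (fun x => ∑ l ∈ S, a t l * torusExp l x) k := by
    have h1 : (fun x => ∑ l ∈ S, a t l * torusExp l x) = fun x => ∑' l, a t l * torusExp l x :=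
      funext fun x => (tsum_eq_sum fun l hl => by rw [hsupp t l hl, zero_mul]).symm
    rw [h1, fourierCoeffC_trigSeries]
    exact summable_of_ne_finset_zero (s := S) fun l hl => by rw [hsupp t l hl, norm_zero]
  rw [hat, fourierCoeffC, fourierCoeffC, ← smul_sub, norm_smul, Real.norm_of_nonneg (by positivity),
    mul_assoc]
  refine mul_le_mul_of_nonneg_left ?_ (by positivity)
  simpa [hF, (hΨ _).1] using hmvt

end AlongTheFlow

section Frozen

variable {s : ℝ} {ω ψ : (Fin 2 → ℝ) → ℝ} {Ψ : ℝ → (Fin 2 → ℝ) → (Fin 2 → ℝ)}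

theorem MemSobolev.summable_norm_coeff (hs : 1 < s) (hω : MemSobolev s ω) :
    Summable fun k => ‖torusFourierCoeff ω k‖ :=
  (summable_of_weighted_sq hs (fun _ => norm_nonneg _) hω.summable_sq).1

/-- A function in `H^s` has a continuous representative, its Fourier series. -/
theorem MemSobolev.ae_eq_trigSeries (hs : 1 < s) (hω : MemSobolev s ω) :
    (fun x => (ω x : ℂ)) =ᵐ[volume] fun x => ∑' k, torusFourierCoeff ω k * torusExp k x := by
  have hωs := hω.summable_norm_coeff hs
  simp only [torusFourierCoeff_eq] at hωs ⊢
  exact _root_.ae_eq_trigSeries (F := fun x => (ω x : ℂ))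
    (fun i x => congrArg Complex.ofReal (hω.periodic i x)) hω.memLp_ofReal hωs

/-- The Fourier coefficients of `ω ∘ Ψₜ` are the limits of those of the Galerkin approximations. -/
theorem tendsto_galerkin_coeff (hs : 2 ≤ s) (h : IsInvLaplacian ω ψ) (hω : MemSobolev s ω)
    (hΨ : IsFlowOf (symplecticGrad ψ) Ψ) {a : ℕ → ℝ → (Fin 2 → ℤ) → ℂ}
    (hsupp : ∀ N t, ∀ k ∉ freqBox N, a N t k = 0)
    (hinit : ∀ N, ∀ k ∈ freqBox N, a N 0 k = torusFourierCoeff ω k)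
    (hder : ∀ N t, ∀ k ∈ freqBox N,
      HasDerivAt (fun r => a N r k) (transportCoeff (torusFourierCoeff ψ) (a N t) k) t)
    {A : ℝ} {t : ℝ} (ht : 0 ≤ t)
    (hA : ∀ N, ∀ r ∈ Icc 0 t, ∑ k ∈ freqBox N, (bracket k ^ s * ‖a N r k‖) ^ 2 ≤ A)
    (k : Fin 2 → ℤ) :
    Tendsto (fun N => a N t k) atTop (𝓝 (torusFourierCoeff (fun x => ω (Ψ t x)) k)) := by
  have hs1 : 1 < s := by linarith
  obtain ⟨K, hK⟩ := h.exists_lipschitzWith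
  obtain ⟨M, hM⟩ := h.cellPeriodic_symplecticGrad.exists_bound h.contDiff_symplecticGrad.continuous
  obtain ⟨C, hC⟩ := hΨ.exists_lintegral_comp_le hK hM t.toNNReal
  have hΨc : ∀ r, Continuous (Ψ r) := fun r => (hΨ.lipschitzWith hK r).continuous
  have hps := h.summable_sq hω
  have hf := (summable_bracket_sq_mul_norm hs1 hps).1
  have hωs := hω.summable_norm_coeff hs1
  have hπ : (0 : ℝ) < (2 * π) ^ 2 := by positivity
  set P := ∑' k, (bracket k ^ (s + 2) * ‖torusFourierCoeff ψ k‖) ^ 2 with hP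
  have hP0 : 0 ≤ P := tsum_nonneg fun k => sq_nonneg _
  set Q := 4 * (embeddingConst s ^ 2 * P * A) with hQ
  -- the dropped transport terms are small in `L¹`, also along the flow
  have hD : ∀ N, 0 < N → ∀ r ∈ Icc 0 t, ∫ x in torusCell,
      ‖∑' k, (if k ∈ freqBox N then 0 else transportCoeff (torusFourierCoeff ψ) (a N r) k)
        * torusExp k (Ψ (t - r) x)‖ ≤ C * ((2 * π) ^ 2 * (1 + Q) / N) := by
    intro N hN r hr
    set R : (Fin 2 → ℝ) → ℂ := fun y => ∑' k, (if k ∈ freqBox N then 0 else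
      transportCoeff (torusFourierCoeff ψ) (a N r) k) * torusExp k y with hR
    have hzero : ∀ k ∉ freqBox N, (bracket k ^ s * ‖a N r k‖) ^ 2 = 0 := fun k hk => by
      rw [hsupp N r k hk, norm_zero, mul_zero, zero_pow two_ne_zero]
    have hcs := (summable_norm_transportCoeff hf (hsupp N r)).1
    obtain ⟨hc2, hc2le⟩ := summable_sq_bracket_mul_transportCoeff hs
      (summable_of_ne_finset_zero hzero) hps
    have hQle : ∑' k, (bracket k * ‖transportCoeff (torusFourierCoeff ψ) (a N r) k‖) ^ 2 ≤ Q := by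
      rw [tsum_eq_sum hzero, ← hP] at hc2le
      refine hc2le.trans ?_
      have := hA N r hr
      rw [hQ]
      gcongr
    have hRcont : Continuous R := continuous_trigSeries (summable_norm_tail hcs _)
    have hcell := integral_norm_tail_le hcs hc2 hQle hN
    have hle := hC (t - r) (by
      rw [Real.coe_toNNReal _ ht, abs_of_nonneg (by linarith [hr.2])]
      linarith [hr.1]) (fun y => ‖R y‖ₑ) hRcont.enorm.measurable
      (cellPeriodic_trigSeries.comp fun z : ℂ => ‖z‖ₑ)
    change ∫ x in torusCell, ‖R (Ψ (t - r) x)‖ ≤ _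
    change ∫ x in torusCell, ‖R x‖ ≤ _ at hcell
    rw [integral_norm_eq_lintegral_enorm (f := fun x => R (Ψ (t - r) x))
      (hRcont.comp (hΨc _)).aestronglyMeasurable]
    rw [integral_norm_eq_lintegral_enorm hRcont.aestronglyMeasurable] at hcell
    have hfin : ∫⁻ x in torusCell, ‖R x‖ₑ ≠ ⊤ :=
      (integrableOn_cell_of_continuous hRcont).hasFiniteIntegral.ne
    calc (∫⁻ x in torusCell, ‖R (Ψ (t - r) x)‖ₑ).toReal
        ≤ (C * ∫⁻ x in torusCell, ‖R x‖ₑ).toReal :=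
          ENNReal.toReal_mono (ENNReal.mul_ne_top ENNReal.coe_ne_top hfin) hle
      _ = C * (∫⁻ x in torusCell, ‖R x‖ₑ).toReal := by
          rw [ENNReal.toReal_mul, ENNReal.coe_toReal]
      _ ≤ _ := by gcongr
  -- the truncation of the initial value
  have hser := hω.ae_eq_trigSeries hs1
  have hinitle : ∀ N, ‖fourierCoeffC (fun x => ∑ l ∈ freqBox N, a N 0 l * torusExp l (Ψ t x)) k
      - torusFourierCoeff (fun x => ω (Ψ t x)) k‖
      ≤ ∑' k, ‖if k ∈ freqBox N then 0 else torusFourierCoeff ω k‖ := by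
    intro N
    set τ := ∑' k, ‖if k ∈ freqBox N then 0 else torusFourierCoeff ω k‖ with hτ
    have htail := summable_norm_tail hωs (freqBox N)
    have hsercont : Continuous fun x => ∑' k, torusFourierCoeff ω k * torusExp k (Ψ t x) :=
      (continuous_trigSeries hωs).comp (hΨc t)
    have hpolcont : Continuous fun x => ∑ l ∈ freqBox N, a N 0 l * torusExp l (Ψ t x) :=
      continuous_finsetSum _ fun l _ => continuous_const.mul
        ((continuous_torusExp l).comp (hΨc t))
    have e1 : torusFourierCoeff (fun x => ω (Ψ t x)) k
        = fourierCoeffC (fun x => ∑' k, torusFourierCoeff ω k * torusExp k (Ψ t x)) k := by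
      rw [torusFourierCoeff_eq, fourierCoeffC, fourierCoeffC]
      congr 1
      refine integral_congr_ae (ae_restrict_of_ae ?_)
      filter_upwards [hΨ.ae_comp hK t hser] with x hx
      rw [hx]
    have e2 : fourierCoeffC (fun x => ∑ l ∈ freqBox N, a N 0 l * torusExp l (Ψ t x)) k
        - fourierCoeffC (fun x => ∑' k, torusFourierCoeff ω k * torusExp k (Ψ t x)) k
        = -fourierCoeffC (fun x => ∑' k, (if k ∈ freqBox N then 0 else torusFourierCoeff ω k)
          * torusExp k (Ψ t x)) k := by
      simp only [fourierCoeffC]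
      rw [← smul_sub, ← integral_sub
        (integrableOn_mul_torusExp (integrableOn_cell_of_continuous hpolcont) _)
        (integrableOn_mul_torusExp (integrableOn_cell_of_continuous hsercont) _),
        ← smul_neg, ← integral_neg]
      congr 1
      refine integral_congr_ae (Eventually.of_forall fun x => ?_)
      dsimp only
      rw [← tsum_sub_sum_eq_tail hωs,
        Finset.sum_congr rfl fun l hl => by rw [hinit N l hl]]
      ring
    rw [e1, e2, norm_neg]
    have hbd : ∫ x in torusCell, ‖∑' k, (if k ∈ freqBox N then 0 else torusFourierCoeff ω k)
        * torusExp k (Ψ t x)‖ ≤ (2 * π) ^ 2 * τ := by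
      have h1 : ∫ _x in torusCell, τ = (2 * π) ^ 2 * τ := by simp [volume_real_torusCell]
      rw [← h1]
      exact integral_mono
        (integrableOn_cell_of_continuous (((continuous_trigSeries htail).comp (hΨc t)).norm))
        (integrableOn_cell_of_continuous continuous_const)
        fun x => norm_trigSeries_le htail _
    refine (norm_fourierCoeffC_le hbd k).trans_eq ?_
    rw [inv_mul_cancel_left₀ hπ.ne']
  rw [tendsto_iff_norm_sub_tendsto_zero]
  have hlim : Tendsto (fun N : ℕ => ((2 * π) ^ 2)⁻¹ * (C * ((2 * π) ^ 2 * (1 + Q) / N)) * t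
      + ∑' k, ‖if k ∈ freqBox N then 0 else torusFourierCoeff ω k‖) atTop (𝓝 0) := by
    have h1 := (((tendsto_const_div_atTop_nhds_zero_nat ((2 * π) ^ 2 * (1 + Q))).const_mul
      (C : ℝ)).const_mul (((2 * π) ^ 2)⁻¹)).mul_const t
    simpa using h1.add (tendsto_tail hωs)
  refine squeeze_zero' (Eventually.of_forall fun N => norm_nonneg _) ?_ hlim
  filter_upwards [eventually_gt_atTop 0] with N hN
  have h1 := norm_galerkin_sub_le hs1 h hω hΨ hΨc (hsupp N) (hder N) ht (hD N hN) k
  exact (norm_sub_le_norm_sub_add_norm_sub _ _ _).trans (add_le_add h1 (hinitle N))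

/-- The estimate for the frozen equation: composition with the flow of `J∇Δ⁻¹ω` preserves the
regularity of `ω`. -/
theorem memSobolev_comp_flow (hs : 2 ≤ s) (h : IsInvLaplacian ω ψ) (hω : MemSobolev s ω)
    (hΨ : IsFlowOf (symplecticGrad ψ) Ψ) {t : ℝ} (ht : 0 ≤ t) :
    MemSobolev s (fun x => ω (Ψ t x)) ∧ sobolevNorm s (fun x => ω (Ψ t x))
      ≤ Real.exp (trilinearConst s * sobolevNorm s ω * t) * sobolevNorm s ω := by
  have hs1 : 1 < s := by linarith
  obtain ⟨K, hK⟩ := h.exists_lipschitzWith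
  have hωs := hω.summable_norm_coeff hs1
  have hC := trilinearConst_nonneg (show 0 ≤ s by linarith)
  choose a hsupp hinit hder using fun N =>
    exists_galerkin (torusFourierCoeff ψ) (freqBox N) (torusFourierCoeff ω)
  set P := ∑' k, (bracket k ^ (s + 2) * ‖torusFourierCoeff ψ k‖) ^ 2 with hP
  set A := sobolevNorm s ω ^ 2 * Real.exp (trilinearConst s * √P * t) with hA
  have hbound : ∀ N, ∀ r ∈ Icc 0 t, ∑ k ∈ freqBox N, (bracket k ^ s * ‖a N r k‖) ^ 2 ≤ A := by
    intro N r hr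
    refine (galerkin_energy_le hs1 (torusFourierCoeff_neg ψ) (h.summable_sq hω) (hsupp N) (hder N)
      hr.1).trans ?_
    have h0 : ∑ k ∈ freqBox N, (bracket k ^ s * ‖a N 0 k‖) ^ 2 ≤ sobolevNorm s ω ^ 2 := by
      rw [Finset.sum_congr rfl fun k hk => by rw [hinit N k hk], sobolevNorm_sq]
      exact hω.summable_sq.sum_le_tsum _ fun k _ => sq_nonneg _
    have := hr.2
    rw [hA]
    gcongr
  have hfin : ∀ F : Finset (Fin 2 → ℤ),
      ∑ k ∈ F, (bracket k ^ s * ‖torusFourierCoeff (fun x => ω (Ψ t x)) k‖) ^ 2 ≤ A := by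
    intro F
    have hlim : Tendsto (fun N => ∑ k ∈ F, (bracket k ^ s * ‖a N t k‖) ^ 2) atTop
        (𝓝 (∑ k ∈ F, (bracket k ^ s * ‖torusFourierCoeff (fun x => ω (Ψ t x)) k‖) ^ 2)) :=
      tendsto_finsetSum _ fun k _ => ((tendsto_galerkin_coeff hs h hω hΨ hsupp hinit hder ht
        hbound k).norm.const_mul _).pow 2
    refine le_of_tendsto hlim (Eventually.of_forall fun N => ?_)
    refine le_trans ?_ (hbound N t ⟨ht, le_rfl⟩)
    have hzero : ∀ k ∉ freqBox N, (bracket k ^ s * ‖a N t k‖) ^ 2 = 0 := fun k hk => by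
      rw [hsupp N t k hk, norm_zero, mul_zero, zero_pow two_ne_zero]
    rw [← tsum_eq_sum (L := SummationFilter.unconditional _) hzero]
    exact (summable_of_ne_finset_zero hzero).sum_le_tsum _ fun k _ => sq_nonneg _
  have hser := hω.ae_eq_trigSeries hs1
  refine ⟨⟨fun i x => ?_, ?_, ?_⟩, ?_⟩
  · rw [hΨ.add_single hK h.cellPeriodic_symplecticGrad, hω.periodic]
  · have hcont := (continuous_trigSeries hωs).comp (hΨ.lipschitzWith hK t).continuous
    refine (memLp_cell_of_continuous hcont 2).re.ae_eq (ae_restrict_of_ae ?_)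
    filter_upwards [hΨ.ae_comp hK t hser] with x hx
    simp only [Function.comp_apply, ← hx]
    simp
  · exact (summable_of_sum_le (fun k => sq_nonneg _) hfin).congr fun k => (sobolevTerm_eq s _ k).symm
  · rw [sobolevNorm_eq]
    refine Real.sqrt_le_iff.2
      ⟨mul_nonneg (Real.exp_pos _).le (sobolevNorm_nonneg s ω), ?_⟩
    refine (Real.tsum_le_of_sum_le (fun k => sq_nonneg _) hfin).trans ?_
    have hexp : Real.exp (trilinearConst s * √P * t)
        ≤ Real.exp (trilinearConst s * (2 * sobolevNorm s ω) * t) := by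
      have := h.sqrt_tsum_le hω
      gcongr
    calc A ≤ sobolevNorm s ω ^ 2 * Real.exp (trilinearConst s * (2 * sobolevNorm s ω) * t) := by
          rw [hA]; gcongr
      _ = _ := by
          rw [mul_pow, ← Real.exp_nat_mul]
          push_cast
          ring_nf

end Frozen

/-! ### The uniform estimate for both equations -/

theorem proposition3p3 (s : ℝ) (hs : 2 ≤ s) :
    ∃ L₀ L₁ : ℝ, 0 < L₀ ∧ 0 < L₁ ∧
      ∀ (B : ℝ) (ω₀ : (Fin 2 → ℝ) → ℝ), 0 < B → MemSobolev s ω₀ → MeanZero ω₀ →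
        sobolevNorm s ω₀ ≤ B →
        ∀ T₀ : ℝ, T₀ < 1 / (L₀ * B) →
          (∀ ω : ℝ → (Fin 2 → ℝ) → ℝ, IsEulerSolution s ω₀ ω → ∀ t ∈ Set.Icc 0 T₀,
            sobolevNorm s (ω t) ≤ min 2 (Real.exp (B * L₁ * t)) * sobolevNorm s ω₀) ∧
          (∀ f : ℝ → (Fin 2 → ℝ) → ℝ, IsFrozenSolution ω₀ f → ∀ t ∈ Set.Icc 0 T₀,
            MemSobolev s (f t) ∧
              sobolevNorm s (f t) ≤ min 2 (Real.exp (B * L₁ * t)) * sobolevNorm s ω₀) := by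
  have hC0 := trilinearConst_nonneg (show 0 ≤ s by linarith)
  set C := 2 * trilinearConst s + 1 with hC
  have hCpos : 0 < C := by positivity
  have hlog : 0 < Real.log 2 := Real.log_pos (by norm_num)
  refine ⟨4 * C / Real.log 2, 2 * C, by positivity, by positivity, ?_⟩
  intro B ω₀ hB hω₀ _ hle T₀ hT₀
  have hT : 4 * C * B * T₀ ≤ Real.log 2 := by
    rw [div_mul_eq_mul_div, one_div_div, lt_div_iff₀ (by positivity)] at hT₀
    linarith
  have hexp : ∀ t ∈ Icc 0 T₀, Real.exp (2 * C * B * t) * sobolevNorm s ω₀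
      ≤ min 2 (Real.exp (B * (2 * C) * t)) * sobolevNorm s ω₀ := by
    intro t ht
    refine mul_le_mul_of_nonneg_right (le_min ?_ ?_) (sobolevNorm_nonneg s ω₀)
    · rw [← Real.le_log_iff_exp_le (by norm_num)]
      refine le_trans ?_ hT
      have h1 : 2 * C * B * t ≤ 2 * C * B * T₀ := by gcongr; exact ht.2
      have h2 : 0 ≤ 2 * C * B * T₀ := by
        have := ht.1.trans ht.2
        positivity
      linarith
    · rw [show 2 * C * B * t = B * (2 * C) * t by ring]
  refine ⟨fun ω hω t ht => ?_, fun f hf t ht => ?_⟩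
  · exact (hω.sobolevNorm_le hs hB hCpos (by linarith) hle hT ht).trans (hexp t ht)
  · obtain ⟨ψ, Ψ, hψ, hΨ, hfΨ⟩ := hf
    rw [show f t = fun x => ω₀ (Ψ t x) from funext (hfΨ t)]
    obtain ⟨h1, h2⟩ := memSobolev_comp_flow hs hψ hω₀ hΨ ht.1
    refine ⟨h1, h2.trans (le_trans ?_ (hexp t ht))⟩
    refine mul_le_mul_of_nonneg_right (Real.exp_le_exp.2 ?_) (sobolevNorm_nonneg s ω₀)
    have := ht.1
    have h3 := sobolevNorm_nonneg s ω₀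
    calc trilinearConst s * sobolevNorm s ω₀ * t ≤ (2 * C) * B * t := by
          gcongr
          linarith
      _ = _ := by ring
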